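/- Let $d\in\mathbb N_0$, let $X\subseteq\mathbb R^d$ be open, let $w\in C^\infty(X)$ be complex-valued such that $\{x\in X : w(x)\neq 0\}$ is dense in $X$, and let $\psi:X\to X$ be smooth and injective with $\det J\psi(x)\neq 0$ for all $x\in X$, where $J\psi$ denotes the Jacobian matrix. Let $\mathscr D'(X)$ be the space of complex distributions on $X$ with the strong dual topology. There is a unique continuous linear operator $C_{w,\psi}$ on $\mathscr D'(X)$ which extends the operator $f\mapsto w\,(f\circ\psi)$ on $C(X)$ (the weighted composition operator). We use the following notions. A continuous linear operator $T$ on a locally convex space $E$ is power bounded if for every continuous seminorm $p$ on $E$ there is a continuous seminorm $q$ on $E$ with $p(T^m x)\le q(x)$ for all $m\in\mathbb N_0$ and $x\in E$. The map $\psi$ has stable orbits if for every compact $K\subseteq X$ there is a compact $L\subseteq X$ with $\psi^m(K)\subseteq L$ for all $m\in\mathbb N_0$. Here $\psi^m$ is the $m$-fold iterate; it is a diffeomorphism from $X$ onto the open set $\psi^m(X)$, and $(\psi^m)^{-1}_c$, $1\le c\le d$, denote the components of its inverse $(\psi^m)^{-1}:\psi^m(X)\to X\subseteq\mathbb R^d$.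 For $f$ smooth on an open set containing the compact set $K$ and for $n\in\mathbb N_0$ put $\|f\|_{n,K}=\sup_{|\alpha|\le n,\,x\in K}|\partial^\alpha f(x)|$. Consider the conditions $$\text{(a)}\qquad \sup_{m\in\mathbb N_0}\Big\|\Big(\prod_{j=0}^{m-1}\frac{w(\psi^j(\cdot))}{|\det J\psi(\psi^j(\cdot))|}\Big)\circ(\psi^m)^{-1}\Big\|_{n,\psi^m(K)}<\infty\quad\text{for all compact }K\subseteq X\text{ and all }n\in\mathbb N_0,$$ $$\text{(b)}\qquad \sup_{m\in\mathbb N_0}\big\|(\psi^m)^{-1}_c\big\|_{n,\psi^m(K)}<\infty\quad\text{for all compact }K\subseteq X,\text{ all }n\in\mathbb N_0\text{ and all }1\le c\le d.$$ Then the following hold. (i) If $\psi$ has stable orbits and (a) and (b) hold, then $C_{w,\psi}$ is power bounded on $\mathscr D'(X)$. (ii) Conversely, if $C_{w,\psi}$ is power bounded on $\mathscr D'(X)$, then $\psi$ has stable orbits and (a) holds. -/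

import Mathlib

open Set Function TopologicalSpace MeasureTheory
open scoped ENNReal ContDiff Distributions

namespace WeightedComposition

/-- The space `𝓓'(X)` of complex distributions on the open set `X ⊆ ℝ^d`: continuous linear
functionals on the LF-space `𝓓(X)` of complex-valued test functions. As the type of continuous
linear maps it carries the topology of uniform convergence on bounded subsets of `𝓓(X)`, i.e. the
strong dual topology. -/
abbrev Distr {d : ℕ} (X : Opens (EuclideanSpace ℝ (Fin d))) : Type :=
  𝓓(X, ℂ) →L[ℂ] ℂ

/-- The regular distribution `φ ↦ ∫ φ f` of a function that is locally integrable on `X`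
(in particular of a function that is continuous on `X`). -/
noncomputable def regularDistr {d : ℕ} (X : Opens (EuclideanSpace ℝ (Fin d)))
    (f : EuclideanSpace ℝ (Fin d) → ℂ) : Distr X :=
  TestFunction.integralAgainstBilinCLM (ContinuousLinearMap.mul ℂ ℂ) volume f

/-- `T` is a continuous linear operator on `𝓓'(X)` which extends the operator
`f ↦ w · (f ∘ ψ)` on `C(X)`. -/
def IsWeightedCompositionOperator {d : ℕ} (X : Opens (EuclideanSpace ℝ (Fin d)))
    (w : EuclideanSpace ℝ (Fin d) → ℂ)
    (ψ : EuclideanSpace ℝ (Fin d) → EuclideanSpace ℝ (Fin d))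
    (T : Distr X →L[ℂ] Distr X) : Prop :=
  ∀ f : EuclideanSpace ℝ (Fin d) → ℂ, ContinuousOn f X →
    T (regularDistr X f) = regularDistr X (fun x => w x * f (ψ x))

/-- A continuous linear operator on a topological vector space is power bounded if for every
continuous seminorm `p` there is a continuous seminorm `q` such that `p (T ^ m x) ≤ q x` for all
`m` and `x`. -/
def IsPowerBounded {E : Type*} [AddCommGroup E] [Module ℂ E] [TopologicalSpace E]
    (T : E →L[ℂ] E) : Prop :=
  ∀ p : Seminorm ℂ E, Continuous p →
    ∃ q : Seminorm ℂ E, Continuous q ∧ ∀ (m : ℕ) (x : E), p (T^[m] x) ≤ q x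

/-- The self-map `ψ` of the set `X` has stable orbits: for every compact `K ⊆ X` there is a compact
`L ⊆ X` which contains `ψ^m(K)` for all `m`. -/
def HasStableOrbits {E : Type*} [TopologicalSpace E] (X : Set E) (ψ : E → E) : Prop :=
  ∀ K : Set E, IsCompact K → K ⊆ X →
    ∃ L : Set E, IsCompact L ∧ L ⊆ X ∧ ∀ m : ℕ, ψ^[m] '' K ⊆ L

/-- The seminorm `‖f‖_{n,K} = sup { |∂^α f(x)| : |α| ≤ n, x ∈ K }` with values in `[0, ∞]`, for `f`
smooth on a neighbourhood of `K`. The partial derivatives of order `k` are written as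
`∂_{β 0} ⋯ ∂_{β (k-1)} f`, with `β` running through all sequences of `k` coordinate directions. -/
noncomputable def cnSeminorm {d : ℕ} {F : Type*} [NormedAddCommGroup F] [NormedSpace ℝ F]
    (n : ℕ) (K : Set (EuclideanSpace ℝ (Fin d))) (f : EuclideanSpace ℝ (Fin d) → F) : ℝ≥0∞ :=
  ⨆ (k : ℕ) (_ : k ≤ n) (β : Fin k → Fin d) (x : EuclideanSpace ℝ (Fin d)) (_ : x ∈ K),
    ‖iteratedFDeriv ℝ k f x (fun i => EuclideanSpace.single (β i) (1 : ℝ))‖ₑ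

/-- `(ψ^m)⁻¹ : ψ^m(X) → X`, the inverse of the injective map `ψ^m : X → ψ^m(X)`
(only its values on `ψ^m(X)` are meaningful). -/
noncomputable def iterateInv {d : ℕ} (X : Set (EuclideanSpace ℝ (Fin d)))
    (ψ : EuclideanSpace ℝ (Fin d) → EuclideanSpace ℝ (Fin d)) (m : ℕ) :
    EuclideanSpace ℝ (Fin d) → EuclideanSpace ℝ (Fin d) :=
  invFunOn (ψ^[m]) X

/-- The weight product `x ↦ ∏_{j < m} w(ψ^j(x)) / |det Jψ(ψ^j(x))|`. -/
noncomputable def weightProduct {d : ℕ} (w : EuclideanSpace ℝ (Fin d) → ℂ)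
    (ψ : EuclideanSpace ℝ (Fin d) → EuclideanSpace ℝ (Fin d)) (m : ℕ)
    (x : EuclideanSpace ℝ (Fin d)) : ℂ :=
  ∏ j ∈ Finset.range m, w (ψ^[j] x) / ((|(fderiv ℝ ψ (ψ^[j] x)).det| : ℝ) : ℂ)

/-- For all compact `K ⊆ X` and all `n`, the functions
`(∏_{j < m} w(ψ^j(·)) / |det Jψ(ψ^j(·))|) ∘ (ψ^m)⁻¹` are bounded in `‖·‖_{n, ψ^m(K)}`
uniformly in `m`. -/
def WeightProductsBounded {d : ℕ} (X : Set (EuclideanSpace ℝ (Fin d)))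
    (w : EuclideanSpace ℝ (Fin d) → ℂ)
    (ψ : EuclideanSpace ℝ (Fin d) → EuclideanSpace ℝ (Fin d)) : Prop :=
  ∀ K : Set (EuclideanSpace ℝ (Fin d)), IsCompact K → K ⊆ X → ∀ n : ℕ,
    ⨆ m : ℕ, cnSeminorm n (ψ^[m] '' K) (weightProduct w ψ m ∘ iterateInv X ψ m) < ⊤

/-- For all compact `K ⊆ X`, all `n` and every coordinate `c`, the components `(ψ^m)⁻¹_c` are
bounded in `‖·‖_{n, ψ^m(K)}` uniformly in `m`. -/
def InverseComponentsBounded {d : ℕ} (X : Set (EuclideanSpace ℝ (Fin d)))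
    (ψ : EuclideanSpace ℝ (Fin d) → EuclideanSpace ℝ (Fin d)) : Prop :=
  ∀ K : Set (EuclideanSpace ℝ (Fin d)), IsCompact K → K ⊆ X → ∀ (n : ℕ) (c : Fin d),
    ⨆ m : ℕ, cnSeminorm n (ψ^[m] '' K) (fun y => iterateInv X ψ m y c) < ⊤

end WeightedComposition

set_option linter.unusedSectionVars false

/-! By change of variables, the operator is the transpose of the transfer operator `f ↦ ((w / |det
Jψ|) · f) ∘ ψ⁻¹` (zero off `ψ(X)`) on test functions, which gives existence
(`isWeightedCompositionOperator_weightedCompositionCLM`). Uniqueness holds because regular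
distributions are strongly dense (`exists_regularDistr_approx`): locally a distribution is a
functional `U` of finitely many derivatives, and applying `U` to translates of a narrow bump gives
an approximating function.

The `m`-th power of the transfer operator has the same form, with `ψ^m` and the weight product
(`coe_iterate_transferCLM`). Strong seminorms are controlled by bounded sets of test functions, that
is, sets with a common compact support and uniform bounds on every derivative.

Sufficiency: stable orbits confine the supports of all iterates of a bounded set, and Leibniz and
Faà di Bruno turn (a) and (b) into derivative bounds, so the union of the orbits is bounded.

Necessity: power boundedness gives `|u(T^m f)| ≤ c · sup_B |u|` for the transfer operator `T`, with
`B` bounded and depending only on `f`. Point evaluations of derivatives as `u` confine the supports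
and bound the derivatives of all `T^m f`. For `f = 1` near `K`, the function `T^m f` equals the
weight product composed with `(ψ^m)⁻¹` near `ψ^m(K)`. This is (a), and since the weight product is
nonzero on a dense set, the confined supports yield stable orbits. -/

namespace WeightedComposition

/-! ### Bounded sets of test functions. -/

section TestFunctions

variable {E : Type*} [NormedAddCommGroup E] [NormedSpace ℝ E] {X : Opens E}

open ContDiffMapSupportedIn

/-- A test function as an element of the space of test functions supported in `K`. -/
noncomputable def toSupportedIn {K : Compacts E} (f : 𝓓(X, ℂ)) (hf : tsupport f ⊆ K) :
    𝓓_{K}(E, ℂ) :=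
  .of_support_subset f.contDiff (subset_closure.trans hf)

theorem ofSupportedIn_toSupportedIn {K : Compacts E} (hK : (K : Set E) ⊆ X) (f : 𝓓(X, ℂ))
    (hf : tsupport f ⊆ K) : TestFunction.ofSupportedIn hK (toSupportedIn f hf) = f := rfl

/-- A seminorm on the space of test functions is continuous if it is so on functions with support in
a fixed compact set. -/
theorem continuous_seminorm_of_bounds (p : Seminorm ℂ 𝓓(X, ℂ))
    (hp : ∀ (K : Compacts E) (hK : (K : Set E) ⊆ X), ∃ (s : Finset ℕ) (C : ℝ), 0 ≤ C ∧
      ∀ f : 𝓓_{K}(E, ℂ), p (TestFunction.ofSupportedIn hK f) ≤ C * (s.sup fun i ↦ N[ℂ]_{K, i}) f) :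
    Continuous p := by
  -- The topology `t` defined by `p` alone is locally convex, so by the universal property of the
  -- inductive limit it is enough to compare it with the topology of each `𝓓_{K}`.
  let P : SeminormFamily ℝ 𝓓(X, ℂ) (Fin 1) := fun _ ↦ p.restrictScalars ℝ
  let t : TopologicalSpace 𝓓(X, ℂ) := P.moduleFilterBasis.topology
  have hP : @WithSeminorms ℝ _ _ _ _ _ P t := @WithSeminorms.mk _ _ _ _ _ _ _ t rfl
  have h1 : @IsTopologicalAddGroup 𝓓(X, ℂ) t _ := hP.topologicalAddGroup
  have h2 : @ContinuousSMul ℝ 𝓓(X, ℂ) _ _ t := hP.continuousSMul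
  have h3 : @LocallyConvexSpace ℝ 𝓓(X, ℂ) _ _ _ _ t := hP.toLocallyConvexSpace
  have hle : TestFunction.topologicalSpace X ℂ ⊤ ≤ t := by
    rw [TestFunction.topologicalSpace_le_iff, TestFunction.originalTop]
    refine iSup₂_le fun K hK ↦ continuous_iff_coinduced_le.1 ?_
    let T : 𝓓_{K}(E, ℂ) →ₗ[ℝ] 𝓓(X, ℂ) :=
      { toFun := TestFunction.ofSupportedIn hK, map_add' := fun _ _ ↦ rfl,
        map_smul' := fun _ _ ↦ rfl }
    obtain ⟨s, C, -, h⟩ := hp K hK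
    refine WithSeminorms.continuous_of_isBounded
      (ContDiffMapSupportedIn.withSeminorms ℝ E ℂ ⊤ K) hP T (.of_real fun _ ↦ ⟨s, C, fun f ↦ ?_⟩)
    refine (h f).trans_eq ?_
    simp only [Seminorm.finset_sup_apply]
    rfl
  have hc : @Continuous _ _ t _ p := hP.continuous_seminorm 0
  exact continuous_le_dom hle hc

/-- The estimates are uniform in `i`, so the pointwise supremum of the family is itself a continuous
seminorm, and its unit ball absorbs `B`. -/
theorem exists_bound_of_isVonNBounded {ι : Type*} (q : ι → Seminorm ℂ 𝓓(X, ℂ))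
    (hq : ∀ (K : Compacts E) (hK : (K : Set E) ⊆ X), ∃ (s : Finset ℕ) (C : ℝ), 0 ≤ C ∧
      ∀ (f : 𝓓_{K}(E, ℂ)) (i : ι),
        q i (TestFunction.ofSupportedIn hK f) ≤ C * (s.sup fun j ↦ N[ℂ]_{K, j}) f)
    {B : Set 𝓓(X, ℂ)} (hB : Bornology.IsVonNBounded ℂ B) :
    ∃ M : ℝ, 0 < M ∧ ∀ f ∈ B, ∀ i, q i f ≤ M := by
  have hbdd : BddAbove (range q) := by
    rw [Seminorm.bddAbove_range_iff]
    intro f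
    obtain ⟨s, C, -, h⟩ := hq ⟨tsupport f, f.hasCompactSupport⟩ f.tsupport_subset
    refine ⟨C * (s.sup fun j ↦ ContDiffMapSupportedIn.seminorm ℂ E ℂ ⊤
      ⟨tsupport f, f.hasCompactSupport⟩ j) (toSupportedIn f subset_rfl), ?_⟩
    rintro _ ⟨i, rfl⟩
    exact h (toSupportedIn f subset_rfl) i
  have hc : Continuous (⨆ i, q i : Seminorm ℂ 𝓓(X, ℂ)) := by
    refine continuous_seminorm_of_bounds _ fun K hK ↦ ?_
    obtain ⟨s, C, hC, h⟩ := hq K hK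
    refine ⟨s, C, hC, fun f ↦ ?_⟩
    rw [Seminorm.iSup_apply hbdd]
    exact Real.iSup_le (h f) (by positivity)
  have h0 : (⨆ i, q i : Seminorm ℂ 𝓓(X, ℂ)).ball 0 1 ∈ nhds (0 : 𝓓(X, ℂ)) :=
    (hc.tendsto' 0 0 (map_zero _)).eventually (gt_mem_nhds one_pos) |>.mono
      fun u hu ↦ by simpa [Seminorm.mem_ball] using hu
  obtain ⟨r, hr, h⟩ := (hB h0).exists_pos
  have h1 := h (r : ℂ) (by simp [abs_of_pos hr])
  refine ⟨r, hr, fun f hf i ↦ ?_⟩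
  obtain ⟨g, hg, rfl⟩ := h1 hf
  have hg' := (Seminorm.mem_ball_zero _).1 hg
  rw [Seminorm.iSup_apply hbdd] at hg'
  simp only [map_smul_eq_mul, Complex.norm_real, Real.norm_eq_abs, abs_of_pos hr]
  have h2 := (le_ciSup ((Seminorm.bddAbove_range_iff.1 hbdd) g) i).trans hg'.le
  nlinarith

/-- The norm of the `k`-th derivative at a point, as a seminorm. -/
noncomputable def derivSeminorm (X : Opens E) (k : ℕ) (x : E) : Seminorm ℂ 𝓓(X, ℂ) :=
  Seminorm.of (fun f ↦ ‖iteratedFDeriv ℝ k f x‖)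
    (fun f g ↦ by
      have : (⇑(f + g) : E → ℂ) = ⇑f + ⇑g := rfl
      rw [this, iteratedFDeriv_add_apply (f.contDiff.of_le (mod_cast le_top)).contDiffAt
        (g.contDiff.of_le (mod_cast le_top)).contDiffAt]
      exact norm_add_le _ _)
    (fun a f ↦ by
      have : (⇑(a • f) : E → ℂ) = a • ⇑f := rfl
      rw [this, iteratedFDeriv_const_smul_apply (f.contDiff.of_le (mod_cast le_top)).contDiffAt,
        norm_smul])

/-- The absolute value at a point times a constant, as a seminorm. -/
noncomputable def evalSeminorm (X : Opens E) (c : ℂ) (x : E) : Seminorm ℂ 𝓓(X, ℂ) :=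
  Seminorm.of (fun f ↦ ‖c * f x‖)
    (fun f g ↦ by
      have : (f + g) x = f x + g x := rfl
      rw [this, mul_add]
      exact norm_add_le _ _)
    (fun a f ↦ by
      have : (a • f) x = a * f x := rfl
      rw [this, mul_left_comm, norm_mul])

theorem exists_iteratedFDeriv_bound_of_isVonNBounded {B : Set 𝓓(X, ℂ)}
    (hB : Bornology.IsVonNBounded ℂ B) (k : ℕ) :
    ∃ M : ℝ, 0 < M ∧ ∀ f ∈ B, ∀ x, ‖iteratedFDeriv ℝ k f x‖ ≤ M := by
  refine exists_bound_of_isVonNBounded (derivSeminorm X k)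
    (fun K hK ↦ ⟨{k}, 1, zero_le_one, fun f x ↦ ?_⟩) hB
  rw [Finset.sup_singleton, one_mul]
  exact norm_iteratedFDeriv_apply_le_seminorm_top ℂ

/-- An exhaustion of an open set by compact sets. -/
theorem exists_compact_exhaustion [FiniteDimensional ℝ E] (X : Opens E) :
    ∃ K : ℕ → Set E, (∀ n, IsCompact (K n)) ∧ (∀ n, K n ⊆ X) ∧
      ∀ L : Set E, IsCompact L → L ⊆ X → ∃ N, ∀ n, N ≤ n → L ⊆ K n := by
  have : LocallyCompactSpace X := X.isOpen.isOpenEmbedding_subtypeVal.locallyCompactSpace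
  let e : CompactExhaustion X := default
  refine ⟨fun n ↦ (↑) '' e n, fun n ↦ (e.isCompact n).image continuous_subtype_val, ?_, ?_⟩
  · rintro n _ ⟨x, -, rfl⟩
    exact x.2
  · intro L hL hLX
    have hL' : IsCompact ((↑) ⁻¹' L : Set X) := by
      rw [Subtype.isCompact_iff]
      refine (congrArg IsCompact (Subtype.image_preimage_coe (X : Set E) L)).mpr ?_
      rwa [inter_eq_right.2 hLX]
    obtain ⟨N, hN⟩ := e.exists_superset_of_isCompact hL'
    exact ⟨N, fun n hn x hx ↦ ⟨⟨x, hLX hx⟩, e.subset hn (hN hx), rfl⟩⟩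

/-- The elements of a bounded set of test functions are supported in a common compact set. -/
theorem exists_compact_of_isVonNBounded [FiniteDimensional ℝ E] {B : Set 𝓓(X, ℂ)}
    (hB : Bornology.IsVonNBounded ℂ B) :
    ∃ K : Compacts E, (K : Set E) ⊆ X ∧ ∀ f ∈ B, tsupport f ⊆ K := by
  by_contra! hcon
  obtain ⟨K, hK, hKX, hKL⟩ := exists_compact_exhaustion X
  have key : ∀ n, ∃ f ∈ B, ∃ x, x ∉ K n ∧ f x ≠ 0 := by
    intro n
    obtain ⟨f, hf, hfK⟩ := hcon ⟨K n, hK n⟩ (hKX n)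
    by_contra! h
    refine hfK (closure_minimal (fun x hx ↦ ?_) (hK n).isClosed)
    by_contra hxK
    exact hx (h f hf x hxK)
  choose f hf x hxK hfx using key
  have hx : ∀ L : Set E, IsCompact L → L ⊆ X → ∃ N, ∀ n, N ≤ n → x n ∉ L := by
    intro L hL hLX
    obtain ⟨N, hN⟩ := hKL L hL hLX
    exact ⟨N, fun n hn hxL ↦ hxK n (hN n hn hxL)⟩
  -- Gliding hump: the weight makes the `n`-th seminorm of `f n` equal to `n`. The points `x n`
  -- leave every compact set, so only finitely many of the seminorms are nonzero on a given `𝓓_{L}`.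
  obtain ⟨M, -, hM⟩ := exists_bound_of_isVonNBounded
    (fun n ↦ evalSeminorm X (n / f n (x n)) (x n)) (fun L hL ↦ by
      obtain ⟨N, hN⟩ := hx L L.isCompact hL
      refine ⟨{0}, ∑ n ∈ Finset.range N, ‖(n / f n (x n) : ℂ)‖, by positivity, fun g n ↦ ?_⟩
      rw [Finset.sup_singleton]
      change ‖(n / f n (x n) : ℂ) * g (x n)‖ ≤ _
      by_cases hn : N ≤ n
      · rw [g.zero_on_compl (hN n hn), Pi.zero_apply, mul_zero, norm_zero]
        positivity
      · rw [norm_mul]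
        gcongr
        · exact Finset.single_le_sum (f := fun n ↦ ‖(n / f n (x n) : ℂ)‖)
            (fun _ _ ↦ norm_nonneg _) (Finset.mem_range.2 (not_le.1 hn))
        · exact norm_apply_le_seminorm ℂ) hB
  obtain ⟨n, hn⟩ := exists_nat_gt M
  have h1 : ‖(n / f n (x n) : ℂ) * f n (x n)‖ ≤ M := hM (f n) (hf n) n
  rw [div_mul_cancel₀ _ (hfx n), Complex.norm_natCast] at h1
  linarith

/-- Boundedness is checked in `𝓓_{K}` and carried over by the continuous inclusion into `𝓓(X, ℂ)`.
-/
theorem isVonNBounded_of_bounds {K : Compacts E} (hK : (K : Set E) ⊆ X) {B : Set 𝓓(X, ℂ)}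
    (hsupp : ∀ f ∈ B, tsupport f ⊆ K)
    (hbound : ∀ k, ∃ M : ℝ, ∀ f ∈ B, ∀ x ∈ K, ‖iteratedFDeriv ℝ k f x‖ ≤ M) :
    Bornology.IsVonNBounded ℂ B := by
  have hB : Bornology.IsVonNBounded ℂ {g : 𝓓_{K}(E, ℂ) | TestFunction.ofSupportedIn hK g ∈ B} := by
    rw [(ContDiffMapSupportedIn.withSeminorms ℂ E ℂ ⊤ K).isVonNBounded_iff_seminorm_bounded]
    intro k
    obtain ⟨M, hM⟩ := hbound k
    refine ⟨max M 0 + 1, by positivity, fun g hg ↦ ?_⟩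
    refine lt_of_le_of_lt ?_ (lt_add_one _)
    rw [ContDiffMapSupportedIn.seminorm_top_le_iff ℂ (le_max_right _ _)]
    exact fun x hx ↦ (hM _ hg x hx).trans (le_max_left _ _)
  refine (hB.image (TestFunction.ofSupportedInCLM ℂ hK)).subset fun f hf ↦ ?_
  exact ⟨toSupportedIn f (hsupp f hf), by simpa [ofSupportedIn_toSupportedIn] using hf, rfl⟩

theorem isVonNBounded_singleton (f : 𝓓(X, ℂ)) : Bornology.IsVonNBounded ℂ {f} := by
  refine isVonNBounded_of_bounds (K := ⟨tsupport f, f.hasCompactSupport⟩) f.tsupport_subset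
    (fun g hg ↦ ?_) fun k ↦ ?_
  · rw [mem_singleton_iff.1 hg]
    rfl
  · obtain ⟨M, hM⟩ := (f.contDiff.continuous_iteratedFDeriv (m := k)
      (mod_cast le_top)).bounded_above_of_compact_support (f.hasCompactSupport.iteratedFDeriv k)
    exact ⟨M, fun g hg x _ ↦ by rw [mem_singleton_iff.1 hg]; exact hM x⟩

end TestFunctions

/-! ### Seminorms of the strong dual topology. -/

section StrongDual

variable {V : Type*} [AddCommGroup V] [Module ℂ V] [TopologicalSpace V]

/-- A continuous seminorm on the strong dual is controlled by a bounded set. -/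
theorem exists_isVonNBounded_of_continuous_seminorm {p : Seminorm ℂ (V →L[ℂ] ℂ)}
    (hp : Continuous p) :
    ∃ B : Set V, Bornology.IsVonNBounded ℂ B ∧ ∃ c : ℝ, 0 < c ∧
      ∀ (u : V →L[ℂ] ℂ) (M : ℝ), 0 < M → (∀ f ∈ B, ‖u f‖ ≤ M) → p u ≤ c * M := by
  have h0 : p.ball 0 1 ∈ nhds (0 : V →L[ℂ] ℂ) :=
    (hp.tendsto' 0 0 (map_zero p)).eventually (gt_mem_nhds one_pos) |>.mono
      fun u hu ↦ by simpa [Seminorm.mem_ball] using hu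
  obtain ⟨⟨B, ε⟩, ⟨hB, hε⟩, hsub⟩ := (ContinuousLinearMap.hasBasis_nhds_zero_of_basis
    (Metric.nhds_basis_closedBall (x := (0 : ℂ)))).mem_iff.1 h0
  refine ⟨B, hB, ε⁻¹, inv_pos.2 hε, fun u M hM hu ↦ ?_⟩
  have hε' : 0 < ε := hε
  -- Rescaling puts `u` into the basic neighbourhood given by `B` and `ε`; this division is why `M`
  -- must be positive.
  have h1 : ((ε / M : ℝ) : ℂ) • u ∈ p.ball 0 1 := by
    refine hsub fun f hf ↦ ?_
    have := hu f hf
    simp only [_root_.smul_apply, smul_eq_mul, mem_closedBall_zero_iff, norm_mul,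
      Complex.norm_real, Real.norm_eq_abs, abs_of_pos (div_pos hε' hM)]
    calc ε / M * ‖u f‖ ≤ ε / M * M := by gcongr
      _ = ε := div_mul_cancel₀ _ hM.ne'
  rw [Seminorm.mem_ball_zero, map_smul_eq_mul, Complex.norm_real, Real.norm_eq_abs,
    abs_of_pos (div_pos hε' hM), div_mul_eq_mul_div, div_lt_one hM] at h1
  rw [inv_mul_eq_div, le_div_iff₀ hε', mul_comm]
  exact h1.le

theorem bddAbove_norm_apply {B : Set V} (hB : Bornology.IsVonNBounded ℂ B) (u : V →L[ℂ] ℂ) :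
    BddAbove (range fun f : B ↦ ‖u f‖) := by
  have h := hB.image u
  rw [NormedSpace.isVonNBounded_iff] at h
  obtain ⟨M, -, h⟩ := h.exists_pos_norm_le
  refine ⟨M, ?_⟩
  rintro _ ⟨f, rfl⟩
  exact h _ (mem_image_of_mem _ f.2)

/-- The supremum over a bounded set, as a seminorm on the strong dual. -/
noncomputable def supSeminorm (B : Set V) (hB : Bornology.IsVonNBounded ℂ B) :
    Seminorm ℂ (V →L[ℂ] ℂ) :=
  Seminorm.of (fun u ↦ ⨆ f : B, ‖u f‖)
    (fun u v ↦ Real.iSup_le (fun f ↦ (norm_add_le _ _).trans (add_le_add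
        (le_ciSup (bddAbove_norm_apply hB u) f) (le_ciSup (bddAbove_norm_apply hB v) f)))
      (add_nonneg (Real.iSup_nonneg fun _ ↦ norm_nonneg _)
        (Real.iSup_nonneg fun _ ↦ norm_nonneg _)))
    (fun a u ↦ by
      simp only [_root_.smul_apply, norm_smul]
      rw [Real.mul_iSup_of_nonneg (norm_nonneg a)])

theorem le_supSeminorm {B : Set V} (hB : Bornology.IsVonNBounded ℂ B) (u : V →L[ℂ] ℂ) {f : V}
    (hf : f ∈ B) : ‖u f‖ ≤ supSeminorm B hB u :=
  le_ciSup (bddAbove_norm_apply hB u) ⟨f, hf⟩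

theorem continuous_supSeminorm {B : Set V} (hB : Bornology.IsVonNBounded ℂ B) :
    Continuous (supSeminorm B hB) := by
  refine Seminorm.continuous' (r := 1) ?_
  refine (ContinuousLinearMap.hasBasis_nhds_zero_of_basis
    (Metric.nhds_basis_closedBall (x := (0 : ℂ)))).mem_iff.2 ⟨⟨B, 1⟩, ⟨hB, one_pos⟩, fun u hu ↦ ?_⟩
  rw [Seminorm.mem_closedBall_zero]
  exact Real.iSup_le (fun f ↦ by simpa using hu f f.2) zero_le_one

end StrongDual

/-! ### Jets, convolutions and factorization through a Banach space. -/

section Regularization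

variable {E : Type*} [NormedAddCommGroup E] [NormedSpace ℝ E]

theorem exists_iteratedFDeriv_bound {F : Type*} [NormedAddCommGroup F] [NormedSpace ℝ F]
    {G : E → F} (hG : ContDiff ℝ ∞ G) (hc : HasCompactSupport G) (n : ℕ) :
    ∃ M : ℝ, 0 ≤ M ∧ ∀ k ≤ n, ∀ x, ‖iteratedFDeriv ℝ k G x‖ ≤ M := by
  have h : ∀ k, ∃ C, ∀ x, ‖iteratedFDeriv ℝ k G x‖ ≤ C := fun k ↦
    (hG.continuous_iteratedFDeriv (mod_cast le_top)).bounded_above_of_compact_support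
      (hc.iteratedFDeriv k)
  choose C hC using h
  have hC0 : ∀ k, 0 ≤ C k := fun k ↦ (norm_nonneg _).trans (hC k 0)
  refine ⟨∑ k ∈ Finset.range (n + 1), C k, Finset.sum_nonneg fun k _ ↦ hC0 k, fun k hk x ↦ ?_⟩
  exact (hC k x).trans (Finset.single_le_sum (f := C) (fun k _ ↦ hC0 k)
    (Finset.mem_range_succ_iff.2 hk))

theorem norm_iteratedFDeriv_sub_le {F : Type*} [NormedAddCommGroup F] [NormedSpace ℝ F]
    {G : E → F} (hG : ContDiff ℝ ∞ G) {k : ℕ} {M : ℝ}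
    (hM : ∀ x, ‖iteratedFDeriv ℝ (k + 1) G x‖ ≤ M) (x y : E) :
    ‖iteratedFDeriv ℝ k G x - iteratedFDeriv ℝ k G y‖ ≤ M * ‖x - y‖ :=
  convex_univ.norm_image_sub_le_of_norm_fderiv_le (𝕜 := ℝ)
    (fun z _ ↦ (hG.differentiable_iteratedFDeriv (mod_cast WithTop.coe_lt_top _)) z)
    (fun z _ ↦ norm_fderiv_iteratedFDeriv.trans_le (hM z)) (mem_univ y) (mem_univ x)

theorem iteratedFDeriv_succ_apply_eq_fderiv {F : Type*} [NormedAddCommGroup F] [NormedSpace ℝ F]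
    {G : E → F} (hG : ContDiff ℝ ∞ G) {k : ℕ} (x : E) (v : Fin (k + 1) → E) :
    iteratedFDeriv ℝ (k + 1) G x v =
      fderiv ℝ (fun y ↦ iteratedFDeriv ℝ k G y (Fin.tail v)) x (v 0) := by
  have hk : DifferentiableAt ℝ (iteratedFDeriv ℝ k G) x :=
    (hG.differentiable_iteratedFDeriv (mod_cast WithTop.coe_lt_top _)) x
  have := ((ContinuousMultilinearMap.apply ℝ (fun _ : Fin k ↦ E) F
    (Fin.tail v)).hasFDerivAt.comp x hk.hasFDerivAt).fderiv
  change _ = fderiv ℝ ((ContinuousMultilinearMap.apply ℝ (fun _ : Fin k ↦ E) F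
    (Fin.tail v)) ∘ iteratedFDeriv ℝ k G) x (v 0)
  rw [iteratedFDeriv_succ_apply_left, this]
  rfl

/-- Differentiation of a convolution falls on the smooth factor. -/
theorem iteratedFDeriv_convolution_apply [FiniteDimensional ℝ E] [MeasurableSpace E] [BorelSpace E]
    (μ : Measure E) [μ.IsAddHaarMeasure]
    {E₁ E₂ F : Type*} [NormedAddCommGroup E₁] [NormedSpace ℝ E₁] [NormedAddCommGroup E₂]
    [NormedSpace ℝ E₂] [NormedAddCommGroup F] [NormedSpace ℝ F] (L : E₁ →L[ℝ] E₂ →L[ℝ] F)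
    {φ : E → E₁} (hφ : LocallyIntegrable φ μ) {G : E → E₂} (hG : ContDiff ℝ ∞ G)
    (hc : HasCompactSupport G) (k : ℕ) (x : E) (v : Fin k → E) :
    iteratedFDeriv ℝ k (convolution φ G L μ) x v =
      convolution φ (fun y ↦ iteratedFDeriv ℝ k G y v) L μ x := by
  induction k generalizing x with
  | zero => simp [iteratedFDeriv_zero_apply]
  | succ k ih =>
    have hh : ContDiff ℝ ∞ (convolution φ G L μ) := hc.contDiff_convolution_right L hφ hG
    rw [iteratedFDeriv_succ_apply_eq_fderiv hh]
    simp_rw [ih]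
    have hG' : ContDiff ℝ ∞ fun y ↦ iteratedFDeriv ℝ k G y (Fin.tail v) :=
      (ContinuousMultilinearMap.apply ℝ (fun _ : Fin k ↦ E) E₂ (Fin.tail v)).contDiff.comp
        (hG.iteratedFDeriv_right (m := ∞) (i := k) (by exact_mod_cast le_top))
    have hc' : HasCompactSupport fun y ↦ iteratedFDeriv ℝ k G y (Fin.tail v) :=
      (hc.iteratedFDeriv k).comp_left (g := fun T : E [×k]→L[ℝ] E₂ ↦ T (Fin.tail v)) rfl
    have hd := hc'.hasFDerivAt_convolution_right L hφ (hG'.of_le (mod_cast le_top)) x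
    rw [hd.fderiv, convolution_def, convolution_def, ContinuousLinearMap.integral_apply]
    · congr with t
      rw [iteratedFDeriv_succ_apply_eq_fderiv hG]
      rfl
    · exact (hc'.fderiv ℝ).convolutionExists_right (L.precompR E) hφ
        (hG'.continuous_fderiv (by simp)) x

/-- Indices for the values of all derivatives up to order `n` on vectors of norm at most one. -/
abbrev JetIndex (E : Type*) [NormedAddCommGroup E] (n : ℕ) : Type _ :=
  {p : ℕ × E × (ℕ → E) // p.1 ≤ n ∧ ∀ i, ‖p.2.2 i‖ ≤ 1}

/-- The Banach space of bounded families indexed by `JetIndex E n`. -/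
abbrev JetSpace (E : Type*) [NormedAddCommGroup E] (n : ℕ) : Type _ :=
  lp (fun _ : JetIndex E n ↦ ℂ) ⊤

theorem norm_iteratedFDeriv_apply_le_of_norm_le_one {F : Type*} [NormedAddCommGroup F]
    [NormedSpace ℝ F] {k : ℕ} (T : E [×k]→L[ℝ] F) {v : ℕ → E} (hv : ∀ i, ‖v i‖ ≤ 1) :
    ‖T (fun i ↦ v i)‖ ≤ ‖T‖ := by
  refine (T.le_opNorm _).trans (mul_le_of_le_one_right (norm_nonneg _) ?_)
  exact Finset.prod_le_one (fun _ _ ↦ norm_nonneg _) fun i _ ↦ hv i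

/-- Multilinearity allows each argument to be normalized. The directions are sequences on `ℕ` so
that one index type serves all orders `k`. -/
theorem norm_le_of_apply_le {F : Type*} [NormedAddCommGroup F]
    [NormedSpace ℝ F] {k : ℕ} (T : E [×k]→L[ℝ] F) {C : ℝ} (hC : 0 ≤ C)
    (h : ∀ v : ℕ → E, (∀ i, ‖v i‖ ≤ 1) → ‖T (fun i ↦ v i)‖ ≤ C) : ‖T‖ ≤ C := by
  refine T.opNorm_le_bound hC fun m ↦ ?_
  let v : ℕ → E := fun i ↦ if hi : i < k then ‖m ⟨i, hi⟩‖⁻¹ • m ⟨i, hi⟩ else 0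
  have hv : ∀ i, ‖v i‖ ≤ 1 := by
    intro i
    by_cases hi : i < k
    · simp only [v, hi, dite_true, norm_smul, norm_inv, norm_norm]
      exact inv_mul_le_one
    · simp [v, hi]
  have hm : m = fun i ↦ ‖m i‖ • v i := by
    ext i
    simp only [v, i.2, dite_true, Fin.eta]
    by_cases h0 : m i = 0
    · simp [h0]
    · rw [smul_inv_smul₀ (norm_ne_zero_iff.2 h0)]
  have : T m = (∏ i, ‖m i‖) • T fun i ↦ v i := by
    conv_lhs => rw [hm]
    exact T.map_smul_univ _ _
  rw [this, norm_smul, mul_comm, Real.norm_of_nonneg (Finset.prod_nonneg fun _ _ ↦ norm_nonneg _)]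
  exact mul_le_mul_of_nonneg_right (h v hv) (Finset.prod_nonneg fun _ _ ↦ norm_nonneg _)

/-- All derivatives up to order `n` of a smooth compactly supported function. -/
noncomputable def jet (n : ℕ) (G : E → ℂ) (hG : ContDiff ℝ ∞ G) (hc : HasCompactSupport G) :
    JetSpace E n :=
  ⟨fun p ↦ iteratedFDeriv ℝ p.1.1 G p.1.2.1 fun i ↦ p.1.2.2 i, by
    obtain ⟨M, -, hM⟩ := exists_iteratedFDeriv_bound hG hc n
    refine memℓp_infty ⟨M, ?_⟩
    rintro _ ⟨p, rfl⟩
    exact (norm_iteratedFDeriv_apply_le_of_norm_le_one _ p.2.2).trans (hM _ p.2.1 _)⟩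

theorem jet_apply (n : ℕ) (G : E → ℂ) (hG : ContDiff ℝ ∞ G) (hc : HasCompactSupport G)
    (p : JetIndex E n) :
    jet n G hG hc p = iteratedFDeriv ℝ p.1.1 G p.1.2.1 fun i ↦ p.1.2.2 i := rfl

theorem norm_iteratedFDeriv_le_norm_jet {n : ℕ} {G : E → ℂ} (hG : ContDiff ℝ ∞ G)
    (hc : HasCompactSupport G) {k : ℕ} (hk : k ≤ n) (x : E) :
    ‖iteratedFDeriv ℝ k G x‖ ≤ ‖jet n G hG hc‖ :=
  norm_le_of_apply_le _ (norm_nonneg _) fun v hv ↦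
    lp.norm_apply_le_norm ENNReal.top_ne_zero (jet n G hG hc) ⟨(k, x, v), hk, hv⟩

/-- The jets of the translates of `G`. -/
theorem continuous_jet_comp_sub (n : ℕ) {G : E → ℂ} (hG : ContDiff ℝ ∞ G)
    (hc : HasCompactSupport G) :
    Continuous fun a : E ↦ jet n (fun x ↦ G (x - a)) (hG.comp (contDiff_id.sub contDiff_const))
      (hc.comp_homeomorph (Homeomorph.subRight a)) := by
  obtain ⟨M, hM0, hM⟩ := exists_iteratedFDeriv_bound hG hc (n + 1)
  -- Translation is Lipschitz into `n`-jets, with a bound for the derivatives up to order `n + 1` as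
  -- its constant.
  refine (LipschitzWith.of_dist_le_mul (K := ⟨M, hM0⟩) fun a b ↦ ?_).continuous
  rw [dist_eq_norm]
  refine lp.norm_le_of_forall_le (by positivity) fun p ↦ ?_
  change ‖iteratedFDeriv ℝ p.1.1 (fun x ↦ G (x - a)) p.1.2.1 (fun i ↦ p.1.2.2 i) -
    iteratedFDeriv ℝ p.1.1 (fun x ↦ G (x - b)) p.1.2.1 (fun i ↦ p.1.2.2 i)‖ ≤ _
  rw [iteratedFDeriv_comp_sub, iteratedFDeriv_comp_sub]
  refine (norm_iteratedFDeriv_apply_le_of_norm_le_one (iteratedFDeriv ℝ p.1.1 G (p.1.2.1 - a) -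
    iteratedFDeriv ℝ p.1.1 G (p.1.2.1 - b)) p.2.2).trans ?_
  refine (norm_iteratedFDeriv_sub_le hG (hM _ (by linarith [p.2.1])) _ _).trans_eq ?_
  rw [sub_sub_sub_cancel_left, norm_sub_rev, dist_eq_norm]
  rfl

/-- Every functional that is bounded with respect to an injective linear map factors through it. -/
theorem exists_continuous_factorization {V Y : Type*} [AddCommGroup V] [Module ℂ V]
    [NormedAddCommGroup Y] [NormedSpace ℂ Y] (J : V →ₗ[ℂ] Y) (hJ : Injective J) (u : V →ₗ[ℂ] ℂ)
    (C : ℝ) (h : ∀ f, ‖u f‖ ≤ C * ‖J f‖) : ∃ U : Y →L[ℂ] ℂ, ∀ f, U (J f) = u f := by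
  let e := LinearEquiv.ofInjective J hJ
  let g : Module.Dual ℂ (LinearMap.range J) := u ∘ₗ e.symm.toLinearMap
  -- Hahn–Banach extends the functional from the range of `J`.
  obtain ⟨U, hU⟩ := exists_extension_norm_eq (LinearMap.range J) (g.mkContinuous C fun y ↦ by
    obtain ⟨f, rfl⟩ := e.surjective y
    change ‖u (e.symm (e f))‖ ≤ C * ‖J f‖
    rw [e.symm_apply_apply]
    exact h f)
  refine ⟨U, fun f ↦ ?_⟩
  have := hU.1 (e f)
  simpa [g, e] using this

end Regularization

/-! ### Strong density of regular distributions. -/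

section Density

open ContDiffMapSupportedIn

variable {d : ℕ} {X : Opens (EuclideanSpace ℝ (Fin d))}

/-- On functions supported in a fixed compact set, a distribution is given by a continuous linear
functional of the derivatives up to some order. -/
theorem exists_jet_factorization (u : Distr X) {K : Compacts (EuclideanSpace ℝ (Fin d))}
    (hK : (K : Set (EuclideanSpace ℝ (Fin d))) ⊆ X) :
    ∃ (n : ℕ) (U : JetSpace (EuclideanSpace ℝ (Fin d)) n →L[ℂ] ℂ), ∀ f : 𝓓(X, ℂ), tsupport f ⊆ K →
      u f = U (jet n f f.contDiff f.hasCompactSupport) := by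
  let u' : 𝓓_{K}(EuclideanSpace ℝ (Fin d), ℂ) →L[ℂ] ℂ := u ∘L TestFunction.ofSupportedInCLM ℂ hK
  obtain ⟨s, C, -, hC⟩ := Seminorm.bound_of_continuous
    (ContDiffMapSupportedIn.withSeminorms ℂ (EuclideanSpace ℝ (Fin d)) ℂ ⊤ K)
    ((normSeminorm ℂ ℂ).comp u'.toLinearMap) (continuous_norm.comp u'.continuous)
  let n := s.sup id
  let J : 𝓓_{K}(EuclideanSpace ℝ (Fin d), ℂ) →ₗ[ℂ] JetSpace (EuclideanSpace ℝ (Fin d)) n :=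
    { toFun := fun f ↦ jet n f f.contDiff f.hasCompactSupport
      map_add' := fun f g ↦ by
        ext p
        have : (⇑(f + g) : _ → ℂ) = ⇑f + ⇑g := rfl
        change jet n _ _ _ p = jet n _ _ _ p + jet n _ _ _ p
        simp only [jet_apply]
        rw [this, iteratedFDeriv_add_apply (f.contDiff.of_le (mod_cast le_top)).contDiffAt
          (g.contDiff.of_le (mod_cast le_top)).contDiffAt]
        rfl
      map_smul' := fun a f ↦ by
        ext p
        have : (⇑(a • f) : _ → ℂ) = a • ⇑f := rfl
        change jet n _ _ _ p = a • jet n _ _ _ p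
        simp only [jet_apply]
        rw [this, iteratedFDeriv_const_smul_apply (f.contDiff.of_le (mod_cast le_top)).contDiffAt]
        rfl }
  have hJ : Injective J := by
    rw [injective_iff_map_eq_zero]
    intro f hf
    ext x
    have h1 := norm_iteratedFDeriv_le_norm_jet f.contDiff f.hasCompactSupport (Nat.zero_le n) x
    have h2 : ‖jet n f f.contDiff f.hasCompactSupport‖ = 0 := by
      change ‖J f‖ = 0
      rw [hf, norm_zero]
    rw [h2, norm_iteratedFDeriv_zero] at h1
    simpa using h1
  obtain ⟨U, hU⟩ := exists_continuous_factorization J hJ u'.toLinearMap C fun f ↦ by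
    refine (hC f).trans ?_
    change (C : ℝ) * _ ≤ _
    refine mul_le_mul_of_nonneg_left ?_ C.2
    refine Seminorm.finset_sup_apply_le (norm_nonneg _) fun i hi ↦ ?_
    rw [ContDiffMapSupportedIn.seminorm_top_le_iff ℂ (norm_nonneg _)]
    exact fun x _ ↦ norm_iteratedFDeriv_le_norm_jet f.contDiff f.hasCompactSupport
      (Finset.le_sup (f := id) hi) x
  exact ⟨n, U, fun f hf ↦ (hU (toSupportedIn f hf)).symm⟩

theorem regularDistr_apply {g : EuclideanSpace ℝ (Fin d) → ℂ} (hg : ContinuousOn g X)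
    (f : 𝓓(X, ℂ)) : regularDistr X g f = ∫ x, f x * g x := by
  have h : LocallyIntegrableOn g X volume :=
    hg.locallyIntegrableOn X.isOpen.measurableSet
  rw [regularDistr, TestFunction.integralAgainstBilinCLM_eq_integral h]
  rfl

/-- Regular distributions are dense with respect to uniform convergence on bounded sets. -/
theorem exists_regularDistr_approx (u : Distr X) {B : Set 𝓓(X, ℂ)}
    (hB : Bornology.IsVonNBounded ℂ B) {ε : ℝ} (hε : 0 < ε) :
    ∃ g : EuclideanSpace ℝ (Fin d) → ℂ, Continuous g ∧ ∀ f ∈ B, ‖(u - regularDistr X g) f‖ ≤ ε := by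
  obtain ⟨K, hK, hBK⟩ := exists_compact_of_isVonNBounded hB
  obtain ⟨n, U, hU⟩ := exists_jet_factorization u hK
  choose M hM0 hM using exists_iteratedFDeriv_bound_of_isVonNBounded hB
  let M' : ℝ := ∑ k ∈ Finset.range (n + 2), M k
  have hM'0 : 0 ≤ M' := Finset.sum_nonneg fun k _ ↦ (hM0 k).le
  have hM' : ∀ k ≤ n, ∀ f ∈ B, ∀ x, ‖iteratedFDeriv ℝ (k + 1) f x‖ ≤ M' := fun k hk f hf x ↦
    (hM (k + 1) f hf x).trans (Finset.single_le_sum (f := M) (fun k _ ↦ (hM0 k).le)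
      (Finset.mem_range.2 (by lia)))
  -- Chosen so that `‖U‖ * M' * δ ≤ ε`; the summand `1` prevents a zero denominator.
  let δ : ℝ := ε / (‖U‖ * M' + 1)
  have hδ : 0 < δ := by positivity
  let φ : ContDiffBump (0 : EuclideanSpace ℝ (Fin d)) := ⟨δ / 2, δ, by positivity, by linarith⟩
  let ρ : EuclideanSpace ℝ (Fin d) → ℝ := φ.normed volume
  have hρ : ContDiff ℝ ∞ ρ := φ.contDiff_normed
  have hρc : HasCompactSupport ρ := φ.hasCompactSupport_normed
  let G : EuclideanSpace ℝ (Fin d) → ℂ := fun x ↦ (ρ x : ℂ)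
  have hG : ContDiff ℝ ∞ G := Complex.ofRealCLM.contDiff.comp hρ
  have hGc : HasCompactSupport G := hρc.comp_left (g := fun x : ℝ ↦ (x : ℂ)) Complex.ofReal_zero
  let j := fun a : EuclideanSpace ℝ (Fin d) ↦ jet n (fun x ↦ G (x - a))
    (hG.comp (contDiff_id.sub contDiff_const)) (hGc.comp_homeomorph (Homeomorph.subRight a))
  have hj : Continuous j := continuous_jet_comp_sub n hG hGc
  have hg : Continuous fun a ↦ U (j a) := U.continuous.comp hj
  -- The approximant is a mollification of `u`. Pairing it with `f` gives `U` applied to `∫ f(a)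
  -- j(a) da`, which is the jet of the convolution of `f` with the bump.
  refine ⟨fun a ↦ U (j a), hg, fun f hf ↦ ?_⟩
  have hint : Integrable fun a ↦ f a • j a :=
    (f.continuous.smul hj).integrable_of_hasCompactSupport f.hasCompactSupport.smul_right
  have h1 : regularDistr X (fun a ↦ U (j a)) f = U (∫ a, f a • j a) := by
    rw [regularDistr_apply hg.continuousOn, ← U.integral_comp_comm hint]
    simp
  have h2 : ‖jet n f f.contDiff f.hasCompactSupport - ∫ a, f a • j a‖ ≤ M' * δ := by
    refine lp.norm_le_of_forall_le (by positivity) fun p ↦ ?_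
    obtain ⟨⟨k, x, v⟩, hk, hv⟩ := p
    have h3 : (∫ a, f a • j a : JetSpace _ n) ⟨(k, x, v), hk, hv⟩ =
        iteratedFDeriv ℝ k (convolution f G (ContinuousLinearMap.mul ℝ ℂ) volume) x
          (fun i ↦ v i) := by
      rw [iteratedFDeriv_convolution_apply volume _ f.continuous.locallyIntegrable hG hGc,
        convolution_def]
      have := (lp.evalCLM ℂ (fun _ : JetIndex (EuclideanSpace ℝ (Fin d)) n ↦ ℂ) ⊤
        ⟨(k, x, v), hk, hv⟩).integral_comp_comm hint
      refine this.symm.trans ?_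
      congr with a
      change f a * iteratedFDeriv ℝ k (fun x ↦ G (x - a)) x (fun i ↦ v i) = _
      rw [iteratedFDeriv_comp_sub]
      rfl
    -- After commuting the factors the derivatives fall on `f`. The remaining error is an average of
    -- `D^k f(y) - D^k f(x)` over the ball of radius `δ`.
    have h4 : convolution f G (ContinuousLinearMap.mul ℝ ℂ) volume =
        convolution ρ f (ContinuousLinearMap.lsmul ℝ ℝ) volume := by
      rw [← convolution_flip]
      ext y
      simp only [convolution_def]
      congr with a
      simp [G, mul_comm]
    change ‖jet n f _ _ ⟨(k, x, v), hk, hv⟩ - (∫ a, f a • j a : JetSpace _ n) _‖ ≤ _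
    rw [h3, h4, iteratedFDeriv_convolution_apply volume _ hρ.continuous.locallyIntegrable
      f.contDiff f.hasCompactSupport, jet_apply, ← dist_eq_norm, dist_comm]
    refine φ.dist_normed_convolution_le ?_ fun y hy ↦ ?_
    · have := f.contDiff.continuous_iteratedFDeriv (m := k) (mod_cast le_top)
      exact Continuous.aestronglyMeasurable (by fun_prop)
    · rw [dist_eq_norm]
      refine (norm_iteratedFDeriv_apply_le_of_norm_le_one
        (iteratedFDeriv ℝ k f y - iteratedFDeriv ℝ k f x) hv).trans ?_
      refine (norm_iteratedFDeriv_sub_le f.contDiff (hM' k hk f hf) y x).trans ?_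
      gcongr
      exact (mem_ball_iff_norm.1 hy).le
  change ‖u f - regularDistr X _ f‖ ≤ ε
  rw [h1, hU f (hBK f hf), ← map_sub]
  refine (U.le_opNorm_of_le h2).trans ?_
  calc ‖U‖ * (M' * δ) = ε * ((‖U‖ * M') / (‖U‖ * M' + 1)) := by simp only [δ]; ring
    _ ≤ ε := mul_le_of_le_one_right hε.le (div_le_one_of_le₀ (by linarith) (by positivity))

/-- A continuous linear operator on distributions is determined by its values on regular
distributions. -/
theorem eq_of_eq_on_regularDistr {T₁ T₂ : Distr X →L[ℂ] Distr X}
    (h : ∀ g : EuclideanSpace ℝ (Fin d) → ℂ, ContinuousOn g X →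
      T₁ (regularDistr X g) = T₂ (regularDistr X g)) : T₁ = T₂ := by
  ext u f
  have hf : Bornology.IsVonNBounded ℂ {f} := isVonNBounded_singleton f
  let D := T₁ - T₂
  obtain ⟨B, hB, c, hc, hBc⟩ := exists_isVonNBounded_of_continuous_seminorm
    (p := (supSeminorm {f} hf).comp D.toLinearMap) ((continuous_supSeminorm hf).comp D.continuous)
  suffices hD : ‖D u f‖ ≤ 0 from sub_eq_zero.1 (norm_le_zero_iff.1 hD)
  refine le_of_forall_pos_le_add fun ε hε ↦ ?_
  obtain ⟨g, hg, hgB⟩ := exists_regularDistr_approx u hB (div_pos hε hc)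
  have h1 := hBc _ _ (div_pos hε hc) hgB
  -- `D` vanishes on regular distributions, so `u` may be replaced by a difference that is small on
  -- `B`.
  have h2 : D (u - regularDistr X g) = D u := by
    rw [map_sub, sub_eq_self]
    exact sub_eq_zero.2 (h g hg.continuousOn)
  rw [zero_add, ← h2]
  refine (le_supSeminorm hf _ (mem_singleton f)).trans (h1.trans_eq ?_)
  exact mul_div_cancel₀ ε hc.ne'

end Density

/-! ### Pushing test functions forward along a smooth embedding. -/

section SmoothSelfMaps

variable {E : Type*} [NormedAddCommGroup E] [NormedSpace ℝ E] [FiniteDimensional ℝ E]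

/-- Smooth injective self-maps of `X` whose derivative is everywhere invertible. -/
structure IsSmoothSelfEmbedding (X : Set E) (Φ : E → E) : Prop where
  contDiffOn : ContDiffOn ℝ ∞ Φ X
  mapsTo : MapsTo Φ X X
  injOn : InjOn Φ X
  det_ne_zero : ∀ x ∈ X, (fderiv ℝ Φ x).det ≠ 0

variable {X : Opens E} {Φ : E → E}

namespace IsSmoothSelfEmbedding

theorem contDiffAt (h : IsSmoothSelfEmbedding (X : Set E) Φ) {x : E} (hx : x ∈ X) :
    ContDiffAt ℝ ∞ Φ x :=
  h.contDiffOn.contDiffAt (X.isOpen.mem_nhds hx)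

theorem differentiableAt (h : IsSmoothSelfEmbedding (X : Set E) Φ) {x : E} (hx : x ∈ X) :
    DifferentiableAt ℝ Φ x :=
  (h.contDiffAt hx).differentiableAt (by simp)

theorem iterate {ψ : E → E} (h : IsSmoothSelfEmbedding (X : Set E) ψ) (m : ℕ) :
    IsSmoothSelfEmbedding (X : Set E) ψ^[m] := by
  induction m with
  | zero =>
    refine ⟨contDiffOn_id, mapsTo_id _, injOn_id _, fun x _ ↦ ?_⟩
    simp [ContinuousLinearMap.det]
  | succ m ih =>
    rw [iterate_succ']
    refine ⟨h.contDiffOn.comp ih.contDiffOn ih.mapsTo, h.mapsTo.comp ih.mapsTo,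
      h.injOn.comp ih.injOn ih.mapsTo, fun x hx ↦ ?_⟩
    rw [fderiv_comp x (h.differentiableAt (ih.mapsTo hx)) (ih.differentiableAt hx)]
    change LinearMap.det ((fderiv ℝ ψ (ψ^[m] x)).toLinearMap ∘ₗ (fderiv ℝ ψ^[m] x).toLinearMap) ≠ 0
    rw [LinearMap.det_comp]
    exact mul_ne_zero (h.det_ne_zero _ (ih.mapsTo hx)) (ih.det_ne_zero _ hx)

theorem hasFDerivAt_equiv (h : IsSmoothSelfEmbedding (X : Set E) Φ) {x : E} (hx : x ∈ X) :
    HasFDerivAt Φ ((fderiv ℝ Φ x).toContinuousLinearEquivOfDetNeZero (h.det_ne_zero x hx) :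
      E →L[ℝ] E) x := by
  convert (h.differentiableAt hx).hasFDerivAt
  ext v
  rfl

theorem map_nhds_eq (h : IsSmoothSelfEmbedding (X : Set E) Φ) {x : E} (hx : x ∈ X) :
    Filter.map Φ (nhds x) = nhds (Φ x) :=
  ((h.contDiffAt hx).hasStrictFDerivAt' (h.hasFDerivAt_equiv hx) (by simp)).map_nhds_eq_of_equiv

theorem isOpen_image (h : IsSmoothSelfEmbedding (X : Set E) Φ) {U : Set E} (hU : IsOpen U)
    (hUX : U ⊆ X) : IsOpen (Φ '' U) := by
  rw [isOpen_iff_mem_nhds]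
  rintro _ ⟨x, hx, rfl⟩
  rw [← h.map_nhds_eq (hUX hx)]
  exact Filter.image_mem_map (hU.mem_nhds hx)

theorem invFunOn_apply (h : IsSmoothSelfEmbedding (X : Set E) Φ) {x : E} (hx : x ∈ X) :
    invFunOn Φ X (Φ x) = x :=
  h.injOn.leftInvOn_invFunOn hx

/-- Near `Φ x` the global inverse coincides with the smooth local inverse of the inverse function
theorem: the latter takes values in `X` there, and `Φ` is injective on `X`. -/
theorem contDiffOn_invFunOn (h : IsSmoothSelfEmbedding (X : Set E) Φ) :
    ContDiffOn ℝ ∞ (invFunOn Φ X) (Φ '' X) := by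
  rintro _ ⟨x, hx, rfl⟩
  have hs := (h.contDiffAt hx).hasStrictFDerivAt' (h.hasFDerivAt_equiv hx) (by simp)
  have hg := (h.contDiffAt hx).to_localInverse (h.hasFDerivAt_equiv hx) (by simp)
  refine (hg.congr_of_eventuallyEq ?_).contDiffWithinAt
  have hX : ∀ᶠ z in nhds (Φ x), hs.localInverse Φ _ x z ∈ X := by
    have := hs.localInverse_continuousAt
    exact this.eventually (by rw [hs.localInverse_apply_image]; exact X.isOpen.mem_nhds hx)
  filter_upwards [hX, hs.eventually_right_inverse] with z hz hz'
  change invFunOn Φ X z = hs.localInverse Φ _ x z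
  conv_lhs => rw [← hz']
  exact h.invFunOn_apply hz

end IsSmoothSelfEmbedding

/-- The function `(W · f) ∘ Φ⁻¹` on `Φ(X)`, extended by zero. -/
noncomputable def pushFun (X : Set E) (Φ : E → E) (W f : E → ℂ) : E → ℂ :=
  indicator (Φ '' X) fun y ↦ (W ∘ invFunOn Φ X) y * f (invFunOn Φ X y)

variable {W f : E → ℂ}

theorem pushFun_apply (h : IsSmoothSelfEmbedding (X : Set E) Φ) {x : E} (hx : x ∈ X) :
    pushFun X Φ W f (Φ x) = W x * f x := by
  rw [pushFun, indicator_of_mem (mem_image_of_mem Φ hx), comp_apply, h.invFunOn_apply hx]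

theorem pushFun_of_notMem {y : E} (hy : y ∉ Φ '' X) : pushFun X Φ W f y = 0 :=
  indicator_of_notMem hy _

theorem pushFun_eventuallyEq (h : IsSmoothSelfEmbedding (X : Set E) Φ) {y : E} (hy : y ∈ Φ '' X) :
    pushFun X Φ W f =ᶠ[nhds y] fun y ↦ (W ∘ invFunOn Φ X) y * f (invFunOn Φ X y) := by
  filter_upwards [(h.isOpen_image X.isOpen subset_rfl).mem_nhds hy] with z hz
  exact indicator_of_mem hz _

theorem isCompact_image (h : IsSmoothSelfEmbedding (X : Set E) Φ) {K : Set E} (hK : IsCompact K)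
    (hKX : K ⊆ X) : IsCompact (Φ '' K) :=
  hK.image_of_continuousOn (h.contDiffOn.continuousOn.mono hKX)

theorem pushFun_eq_zero (h : IsSmoothSelfEmbedding (X : Set E) Φ) {K : Set E}
    (hf : tsupport f ⊆ K) {y : E} (hy : y ∉ Φ '' K) : pushFun X Φ W f y = 0 := by
  by_cases hyX : y ∈ Φ '' X
  · obtain ⟨x, hx, rfl⟩ := hyX
    rw [pushFun_apply h hx, image_eq_zero_of_notMem_tsupport fun hxf ↦
      hy (mem_image_of_mem Φ (hf hxf)), mul_zero]
  · exact pushFun_of_notMem hyX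

theorem tsupport_pushFun_subset (h : IsSmoothSelfEmbedding (X : Set E) Φ) {K : Set E}
    (hK : IsCompact K) (hKX : K ⊆ X) (hf : tsupport f ⊆ K) :
    tsupport (pushFun X Φ W f) ⊆ Φ '' K := by
  refine closure_minimal (fun y hy ↦ ?_) (isCompact_image h hK hKX).isClosed
  by_contra hyK
  exact hy (pushFun_eq_zero h hf hyK)

theorem contDiffOn_comp_invFunOn (h : IsSmoothSelfEmbedding (X : Set E) Φ)
    (hW : ContDiffOn ℝ ∞ W X) : ContDiffOn ℝ ∞ (W ∘ invFunOn Φ X) (Φ '' X) :=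
  hW.comp h.contDiffOn_invFunOn (by rintro _ ⟨x, hx, rfl⟩; rwa [h.invFunOn_apply hx])

/-- Inside the open set `Φ(X)` this is composition of smooth maps. A point outside `Φ(X)` misses the
compact set `Φ(tsupport f)`, so the function vanishes near it. -/
theorem contDiff_pushFun (h : IsSmoothSelfEmbedding (X : Set E) Φ) (hW : ContDiffOn ℝ ∞ W X)
    (hf : ContDiff ℝ ∞ f) (hc : HasCompactSupport f) (hfX : tsupport f ⊆ X) :
    ContDiff ℝ ∞ (pushFun X Φ W f) := by
  rw [contDiff_iff_contDiffAt]
  intro y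
  by_cases hy : y ∈ Φ '' X
  · have hn := (h.isOpen_image X.isOpen subset_rfl).mem_nhds hy
    refine ContDiffAt.congr_of_eventuallyEq ?_ (pushFun_eventuallyEq h hy)
    exact ((contDiffOn_comp_invFunOn h hW).contDiffAt hn).mul
      (hf.contDiffAt.comp y (h.contDiffOn_invFunOn.contDiffAt hn))
  · have hy' : y ∉ tsupport (pushFun X Φ W f) := fun hyt ↦
      hy (image_mono hfX (tsupport_pushFun_subset h hc hfX subset_rfl hyt))
    exact contDiffAt_const.congr_of_eventuallyEq (notMem_tsupport_iff_eventuallyEq.1 hy')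

/-- Leibniz for the product and Faà di Bruno for `f ∘ g`. The latter needs the `i`-th derivative of
`g` bounded by `D ^ i`, which follows from the bound `D` because `1 ≤ D`. -/
theorem norm_iteratedFDeriv_mul_comp_le {V : Set E} (hV : IsOpen V) {a : E → ℂ} {g : E → E}
    (ha : ContDiffOn ℝ ∞ a V) (hg : ContDiffOn ℝ ∞ g V) (hf : ContDiff ℝ ∞ f) {y : E} (hy : y ∈ V)
    {n : ℕ} {A D M : ℝ} (hA : ∀ i ≤ n, ‖iteratedFDeriv ℝ i a y‖ ≤ A)
    (hD : ∀ i ≤ n, ‖iteratedFDeriv ℝ i g y‖ ≤ D) (hD1 : 1 ≤ D)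
    (hM : ∀ i ≤ n, ‖iteratedFDeriv ℝ i f (g y)‖ ≤ M) :
    ‖iteratedFDeriv ℝ n (fun z ↦ a z * f (g z)) y‖ ≤ 2 ^ n * A * (n.factorial * M * D ^ n) := by
  have hA0 : 0 ≤ A := (norm_nonneg _).trans (hA 0 n.zero_le)
  have hM0 : 0 ≤ M := (norm_nonneg _).trans (hM 0 n.zero_le)
  have hcomp : ∀ k ≤ n, ‖iteratedFDerivWithin ℝ k (f ∘ g) V y‖ ≤ n.factorial * M * D ^ n := by
    intro k hk
    refine (norm_iteratedFDerivWithin_comp_le (N := ∞) (C := M) (D := D) hf.contDiffOn hg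
      (mod_cast le_top) uniqueDiffOn_univ hV.uniqueDiffOn (mapsTo_univ g V) hy (fun i hi ↦ ?_)
      (fun i hi hik ↦ ?_)).trans ?_
    · rw [iteratedFDerivWithin_univ]
      exact hM i (hi.trans hk)
    · rw [iteratedFDerivWithin_of_isOpen i hV hy]
      exact (hD i (hik.trans hk)).trans (le_self_pow₀ hD1 (by lia))
    · have := Nat.factorial_le hk
      gcongr
  rw [← iteratedFDerivWithin_of_isOpen n hV hy]
  refine (norm_iteratedFDerivWithin_mul_le (N := ∞) ha (hf.comp_contDiffOn hg) hV.uniqueDiffOn hy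
    (mod_cast le_top)).trans ?_
  calc ∑ i ∈ Finset.range (n + 1), (n.choose i : ℝ) * ‖iteratedFDerivWithin ℝ i a V y‖ *
        ‖iteratedFDerivWithin ℝ (n - i) (f ∘ g) V y‖
      ≤ ∑ i ∈ Finset.range (n + 1), (n.choose i : ℝ) * A * (n.factorial * M * D ^ n) := by
        gcongr with i hi
        · rw [iteratedFDerivWithin_of_isOpen i hV hy]
          exact hA i (Finset.mem_range_succ_iff.1 hi)
        · exact hcomp _ (Nat.sub_le n i)
    _ = 2 ^ n * A * (n.factorial * M * D ^ n) := by
        rw [← Finset.sum_mul, ← Finset.sum_mul, ← Nat.cast_sum, Nat.sum_range_choose]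
        push_cast
        ring

theorem norm_iteratedFDeriv_pushFun_le (h : IsSmoothSelfEmbedding (X : Set E) Φ)
    (hW : ContDiffOn ℝ ∞ W X) (hf : ContDiff ℝ ∞ f) {y : E} (hy : y ∈ Φ '' X)
    {n : ℕ} {A D M : ℝ} (hA : ∀ i ≤ n, ‖iteratedFDeriv ℝ i (W ∘ invFunOn Φ X) y‖ ≤ A)
    (hD : ∀ i ≤ n, ‖iteratedFDeriv ℝ i (invFunOn Φ X) y‖ ≤ D) (hD1 : 1 ≤ D)
    (hM : ∀ i ≤ n, ∀ x, ‖iteratedFDeriv ℝ i f x‖ ≤ M) :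
    ‖iteratedFDeriv ℝ n (pushFun X Φ W f) y‖ ≤ 2 ^ n * A * (n.factorial * M * D ^ n) := by
  rw [((pushFun_eventuallyEq h hy).iteratedFDeriv ℝ n).eq_of_nhds]
  exact norm_iteratedFDeriv_mul_comp_le (h.isOpen_image X.isOpen subset_rfl)
    (contDiffOn_comp_invFunOn h hW) h.contDiffOn_invFunOn hf hy hA hD hD1 fun i hi ↦ hM i hi _

theorem exists_iteratedFDeriv_bound_of_isCompact {F : Type*} [NormedAddCommGroup F]
    [NormedSpace ℝ F] {V K : Set E} (hV : IsOpen V) (hK : IsCompact K) (hKV : K ⊆ V) {G : E → F}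
    (hG : ContDiffOn ℝ ∞ G V) (n : ℕ) :
    ∃ M : ℝ, 1 ≤ M ∧ ∀ i ≤ n, ∀ y ∈ K, ‖iteratedFDeriv ℝ i G y‖ ≤ M := by
  have h : ∀ i, ∃ C, ∀ y ∈ K, ‖iteratedFDeriv ℝ i G y‖ ≤ C := fun i ↦ by
    refine hK.exists_bound_of_continuousOn ?_
    refine ContinuousOn.mono ?_ hKV
    exact (hG.continuousOn_iteratedFDerivWithin (mod_cast le_top) hV.uniqueDiffOn).congr
      fun y hy ↦ (iteratedFDerivWithin_of_isOpen i hV hy).symm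
  choose C hC using h
  refine ⟨1 + ∑ i ∈ Finset.range (n + 1), |C i|, ?_, fun i hi y hy ↦ ?_⟩
  · exact le_add_of_nonneg_right (Finset.sum_nonneg fun _ _ ↦ abs_nonneg _)
  · refine (hC i y hy).trans ((le_abs_self _).trans ?_)
    refine (Finset.single_le_sum (f := fun i ↦ |C i|) (fun _ _ ↦ abs_nonneg _)
      (Finset.mem_range_succ_iff.2 hi)).trans (le_add_of_nonneg_left zero_le_one)

open ContDiffMapSupportedIn in
/-- `f ↦ (W · f) ∘ Φ⁻¹`, on test functions supported in a fixed compact set. -/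
noncomputable def pushSupportedInCLM (h : IsSmoothSelfEmbedding (X : Set E) Φ)
    (hW : ContDiffOn ℝ ∞ W X) (K : Compacts E) (hK : (K : Set E) ⊆ X) :
    𝓓_{K}(E, ℂ) →L[ℂ] 𝓓_{(⟨Φ '' K, isCompact_image h K.isCompact hK⟩ : Compacts E)}(E, ℂ) :=
  ContDiffMapSupportedIn.mkCLM ℂ (fun f ↦ pushFun X Φ W f)
    (fun f g y ↦ by
      by_cases hy : y ∈ Φ '' X
      · obtain ⟨x, hx, rfl⟩ := hy
        simp only [pushFun_apply h hx]
        exact mul_add _ _ _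
      · simp only [pushFun_of_notMem hy, add_zero])
    (fun c f y ↦ by
      by_cases hy : y ∈ Φ '' X
      · obtain ⟨x, hx, rfl⟩ := hy
        simp only [pushFun_apply h hx]
        exact mul_left_comm _ _ _
      · simp only [pushFun_of_notMem hy, smul_zero])
    (fun f ↦ contDiff_pushFun h hW f.contDiff f.hasCompactSupport (f.tsupport_subset.trans hK))
    (fun f y hy ↦ pushFun_eq_zero h f.tsupport_subset hy)
    (fun n _ ↦ by
      have hV := h.isOpen_image X.isOpen subset_rfl
      obtain ⟨A, hA1, hA⟩ := exists_iteratedFDeriv_bound_of_isCompact hV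
        (isCompact_image h K.isCompact hK) (image_mono hK) (contDiffOn_comp_invFunOn h hW) n
      obtain ⟨D, hD1, hD⟩ := exists_iteratedFDeriv_bound_of_isCompact hV
        (isCompact_image h K.isCompact hK) (image_mono hK) h.contDiffOn_invFunOn n
      refine ⟨Finset.Iic n, 2 ^ n * A * (n.factorial * D ^ n), by positivity, fun f y hy ↦ ?_⟩
      refine (norm_iteratedFDeriv_pushFun_le h hW f.contDiff (image_mono hK hy)
        (fun i hi ↦ hA i hi y hy) (fun i hi ↦ hD i hi y hy) hD1 (fun i hi x ↦
          (norm_iteratedFDeriv_apply_le_seminorm_top ℂ).trans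
            (Seminorm.le_finset_sup_apply (Finset.mem_Iic.2 hi)))).trans_eq ?_
      ring)

/-- `f ↦ (W · f) ∘ Φ⁻¹` as a continuous linear operator on test functions. -/
noncomputable def pushCLM (h : IsSmoothSelfEmbedding (X : Set E) Φ) (hW : ContDiffOn ℝ ∞ W X) :
    𝓓(X, ℂ) →L[ℂ] 𝓓(X, ℂ) :=
  TestFunction.limitCLM ℂ
    (fun f ↦ ⟨pushFun X Φ W f, contDiff_pushFun h hW f.contDiff f.hasCompactSupport
        f.tsupport_subset,
      (isCompact_image h f.hasCompactSupport f.tsupport_subset).of_isClosed_subset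
        (isClosed_tsupport _)
        (tsupport_pushFun_subset h f.hasCompactSupport f.tsupport_subset subset_rfl),
      (tsupport_pushFun_subset h f.hasCompactSupport f.tsupport_subset subset_rfl).trans
        ((image_mono f.tsupport_subset).trans h.mapsTo.image_subset)⟩)
    (fun K hK ↦ TestFunction.ofSupportedInCLM ℂ
      (K := ⟨Φ '' K, isCompact_image h K.isCompact hK⟩)
      ((image_mono hK).trans h.mapsTo.image_subset) ∘L pushSupportedInCLM h hW K hK)
    (fun _ _ _ ↦ rfl)

theorem coe_pushCLM (h : IsSmoothSelfEmbedding (X : Set E) Φ) (hW : ContDiffOn ℝ ∞ W X)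
    (f : 𝓓(X, ℂ)) : ⇑(pushCLM h hW f) = pushFun X Φ W f := rfl

/-- In a basis the determinant is a polynomial in the matrix entries. -/
theorem contDiff_det : ContDiff ℝ ∞ fun A : E →L[ℝ] E ↦ A.det := by
  let b := Module.finBasis ℝ E
  have : (fun A : E →L[ℝ] E ↦ A.det) = fun A ↦ ∑ σ : Equiv.Perm (Fin (Module.finrank ℝ E)),
      (Equiv.Perm.sign σ : ℝ) * ∏ i, b.coord (σ i) (A (b i)) := by
    ext A
    change LinearMap.det A.toLinearMap = _
    rw [← LinearMap.det_toMatrix b, Matrix.det_apply']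
    simp [LinearMap.toMatrix_apply]
  rw [this]
  refine ContDiff.sum fun σ _ ↦ contDiff_const.mul (contDiff_prod fun i _ ↦ ?_)
  exact ((b.coord (σ i)).toContinuousLinearMap ∘L ContinuousLinearMap.apply ℝ E (b i)).contDiff

end SmoothSelfMaps

/-! ### Coordinate partial derivatives versus operator norms. -/

section Seminorms

variable {d : ℕ} {F : Type*} [NormedAddCommGroup F] [NormedSpace ℝ F]

/-- Expanding every argument in the standard basis bounds the operator norm by the coordinate
partials that occur in `cnSeminorm`. -/
theorem norm_le_sum_single {k : ℕ} (T : (EuclideanSpace ℝ (Fin d)) [×k]→L[ℝ] F) :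
    ‖T‖ ≤ ∑ β : Fin k → Fin d, ‖T fun i ↦ EuclideanSpace.single (β i) (1 : ℝ)‖ := by
  refine T.opNorm_le_bound (Finset.sum_nonneg fun _ _ ↦ norm_nonneg _) fun v ↦ ?_
  have hv : v = fun i ↦ ∑ c, v i c • EuclideanSpace.single c (1 : ℝ) := by
    ext i : 1
    have := (EuclideanSpace.basisFun (Fin d) ℝ).sum_repr (v i)
    simpa using this.symm
  conv_lhs => rw [hv]
  rw [← T.coe_coe, MultilinearMap.map_sum, Finset.sum_mul]
  refine (norm_sum_le _ _).trans (Finset.sum_le_sum fun β _ ↦ ?_)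
  rw [MultilinearMap.map_smul_univ, norm_smul, mul_comm, norm_prod]
  refine mul_le_mul_of_nonneg_left ?_ (norm_nonneg _)
  exact Finset.prod_le_prod (fun _ _ ↦ norm_nonneg _) fun i _ ↦ PiLp.norm_apply_le (v i) (β i)

theorem exists_norm_iteratedFDeriv_bound {n : ℕ} {K : ℕ → Set (EuclideanSpace ℝ (Fin d))}
    {G : ℕ → EuclideanSpace ℝ (Fin d) → F} (h : ⨆ m, cnSeminorm n (K m) (G m) < ⊤) :
    ∃ M : ℝ, 0 ≤ M ∧ ∀ m, ∀ k ≤ n, ∀ y ∈ K m, ‖iteratedFDeriv ℝ k (G m) y‖ ≤ M := by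
  set C := ⨆ m, cnSeminorm n (K m) (G m) with hC
  have hb : ∀ m, ∀ k ≤ n, ∀ y ∈ K m, ∀ β : Fin k → Fin d,
      ‖iteratedFDeriv ℝ k (G m) y fun i ↦ EuclideanSpace.single (β i) (1 : ℝ)‖ ≤ C.toReal := by
    intro m k hk y hy β
    have h1 : ‖iteratedFDeriv ℝ k (G m) y fun i ↦ EuclideanSpace.single (β i) (1 : ℝ)‖ₑ ≤ C := by
      refine le_trans ?_ (le_iSup _ m)
      rw [cnSeminorm]
      exact le_iSup₂_of_le k hk (le_iSup_of_le β (le_iSup₂_of_le y hy le_rfl))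
    have h2 := ENNReal.toReal_mono h.ne h1
    rwa [toReal_enorm] at h2
  refine ⟨∑ k ∈ Finset.range (n + 1), ∑ _β : Fin k → Fin d, C.toReal, by positivity,
    fun m k hk y hy ↦ (norm_le_sum_single _).trans ?_⟩
  refine (Finset.sum_le_sum fun β _ ↦ hb m k hk y hy β).trans ?_
  exact Finset.single_le_sum (f := fun k ↦ ∑ _β : Fin k → Fin d, C.toReal)
    (fun _ _ ↦ by positivity) (Finset.mem_range_succ_iff.2 hk)

theorem iSup_cnSeminorm_lt_top {n : ℕ} {K : ℕ → Set (EuclideanSpace ℝ (Fin d))}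
    {G : ℕ → EuclideanSpace ℝ (Fin d) → F} {M : ℝ}
    (h : ∀ m, ∀ k ≤ n, ∀ y ∈ K m, ‖iteratedFDeriv ℝ k (G m) y‖ ≤ M) :
    ⨆ m, cnSeminorm n (K m) (G m) < ⊤ := by
  refine lt_of_le_of_lt (iSup_le fun m ↦ ?_) (ENNReal.ofReal_lt_top (r := M))
  rw [cnSeminorm]
  refine iSup₂_le fun k hk ↦ iSup_le fun β ↦ iSup₂_le fun y hy ↦ ?_
  rw [← ofReal_norm]
  refine ENNReal.ofReal_le_ofReal (le_trans ?_ (h m k hk y hy))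
  refine (ContinuousMultilinearMap.le_opNorm _ _).trans_eq ?_
  simp

theorem norm_iteratedFDeriv_le_sum_components {g : EuclideanSpace ℝ (Fin d) →
    EuclideanSpace ℝ (Fin d)} {y : EuclideanSpace ℝ (Fin d)} (hg : ContDiffAt ℝ ∞ g y) (k : ℕ) :
    ‖iteratedFDeriv ℝ k g y‖ ≤ ∑ c, ‖iteratedFDeriv ℝ k (fun z ↦ g z c) y‖ := by
  refine ContinuousMultilinearMap.opNorm_le_bound (Finset.sum_nonneg fun _ _ ↦ norm_nonneg _)
    fun v ↦ ?_
  have hc : ∀ c, iteratedFDeriv ℝ k (fun z ↦ g z c) y v = iteratedFDeriv ℝ k g y v c := fun c ↦ by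
    have := (EuclideanSpace.proj c : EuclideanSpace ℝ (Fin d) →L[ℝ] ℝ).iteratedFDeriv_comp_left
      hg (i := k) (mod_cast le_top)
    exact congrArg (fun T ↦ T v) this
  have hsum : ∀ x : EuclideanSpace ℝ (Fin d), ‖x‖ ≤ ∑ c, ‖x c‖ := fun x ↦ by
    have := (EuclideanSpace.basisFun (Fin d) ℝ).sum_repr x
    conv_lhs => rw [← this]
    refine (norm_sum_le _ _).trans (Finset.sum_le_sum fun c _ ↦ ?_)
    simp [norm_smul]
  refine (hsum _).trans ?_
  rw [Finset.sum_mul]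
  refine Finset.sum_le_sum fun c _ ↦ ?_
  rw [← hc]
  exact ContinuousMultilinearMap.le_opNorm _ _

end Seminorms

/-! ### The transfer operator, its iterates and its transpose. -/

section Operator

variable {d : ℕ} {X : Opens (EuclideanSpace ℝ (Fin d))} {w : EuclideanSpace ℝ (Fin d) → ℂ}
  {ψ : EuclideanSpace ℝ (Fin d) → EuclideanSpace ℝ (Fin d)}

/-- The factor `w / |det Jψ|`. -/
noncomputable def weightFactor (w : EuclideanSpace ℝ (Fin d) → ℂ)
    (ψ : EuclideanSpace ℝ (Fin d) → EuclideanSpace ℝ (Fin d)) (x : EuclideanSpace ℝ (Fin d)) : ℂ :=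
  w x / ((|(fderiv ℝ ψ x).det| : ℝ) : ℂ)

theorem contDiffOn_weightFactor (hψ : IsSmoothSelfEmbedding (X : Set (EuclideanSpace ℝ (Fin d))) ψ)
    (hw : ContDiffOn ℝ ∞ w X) : ContDiffOn ℝ ∞ (weightFactor w ψ) X := by
  have hdet : ContDiffOn ℝ ∞ (fun x ↦ (fderiv ℝ ψ x).det) X :=
    contDiff_det.comp_contDiffOn (hψ.contDiffOn.fderiv_of_isOpen X.isOpen (by simp))
  have habs : ContDiffOn ℝ ∞ (fun x ↦ |(fderiv ℝ ψ x).det|) X := fun x hx ↦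
    ContDiffAt.comp_contDiffWithinAt (g := fun t : ℝ ↦ |t|) x
      (contDiffAt_abs (hψ.det_ne_zero x hx)) (hdet x hx)
  have hof : ContDiffOn ℝ ∞ (fun x ↦ ((|(fderiv ℝ ψ x).det| : ℝ) : ℂ)) X :=
    Complex.ofRealCLM.contDiff.comp_contDiffOn habs
  have hinv := hof.inv fun x hx ↦ by simpa using hψ.det_ne_zero x hx
  exact (hw.mul hinv).congr fun x _ ↦ div_eq_mul_inv _ _

theorem weightProduct_succ (m : ℕ) (x : EuclideanSpace ℝ (Fin d)) :
    weightProduct w ψ (m + 1) x = weightProduct w ψ m x * weightFactor w ψ (ψ^[m] x) :=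
  Finset.prod_range_succ _ _

theorem contDiffOn_weightProduct
    (hψ : IsSmoothSelfEmbedding (X : Set (EuclideanSpace ℝ (Fin d))) ψ)
    (hw : ContDiffOn ℝ ∞ w X) (m : ℕ) : ContDiffOn ℝ ∞ (weightProduct w ψ m) X := by
  induction m with
  | zero => exact contDiffOn_const.congr fun x _ ↦ Finset.prod_range_zero _
  | succ m ih =>
    refine (ih.mul ((contDiffOn_weightFactor hψ hw).comp (hψ.iterate m).contDiffOn
      (hψ.iterate m).mapsTo)).congr fun x _ ↦ weightProduct_succ m x

/-- The operator on test functions whose transpose is the weighted composition operator. -/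
noncomputable def transferCLM (hψ : IsSmoothSelfEmbedding (X : Set (EuclideanSpace ℝ (Fin d))) ψ)
    (hw : ContDiffOn ℝ ∞ w X) : 𝓓(X, ℂ) →L[ℂ] 𝓓(X, ℂ) :=
  pushCLM hψ (contDiffOn_weightFactor hψ hw)

theorem coe_iterate_transferCLM
    (hψ : IsSmoothSelfEmbedding (X : Set (EuclideanSpace ℝ (Fin d))) ψ)
    (hw : ContDiffOn ℝ ∞ w X) (m : ℕ) (f : 𝓓(X, ℂ)) :
    ⇑((transferCLM hψ hw)^[m] f) = pushFun X ψ^[m] (weightProduct w ψ m) f := by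
  induction m with
  | zero =>
    ext y
    by_cases hy : y ∈ X
    · have := pushFun_apply (hψ.iterate 0) (W := weightProduct w ψ 0) (f := f) hy
      simpa [weightProduct] using this.symm
    · rw [pushFun_of_notMem (by simpa using hy)]
      exact image_eq_zero_of_notMem_tsupport fun h ↦ hy (f.tsupport_subset h)
  | succ m ih =>
    ext y
    rw [iterate_succ_apply']
    change pushFun X ψ (weightFactor w ψ) ((transferCLM hψ hw)^[m] f) y = _
    rw [ih]
    by_cases hy : y ∈ ψ '' X
    · obtain ⟨z, hz, rfl⟩ := hy
      rw [pushFun_apply hψ hz]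
      by_cases hzm : z ∈ ψ^[m] '' X
      · obtain ⟨x, hx, rfl⟩ := hzm
        rw [pushFun_apply (hψ.iterate m) hx, ← iterate_succ_apply' ψ m x,
          pushFun_apply (hψ.iterate (m + 1)) hx, weightProduct_succ]
        ring
      -- By injectivity of `ψ`, a point `z ∉ ψ^m(X)` has `ψ z ∉ ψ^(m+1)(X)`, so both sides vanish.
      · rw [pushFun_of_notMem hzm, mul_zero, pushFun_of_notMem]
        rintro ⟨x, hx, hxz⟩
        rw [iterate_succ_apply'] at hxz
        exact hzm ⟨x, hx, hψ.injOn ((hψ.iterate m).mapsTo hx) hz hxz⟩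
    · rw [pushFun_of_notMem hy, pushFun_of_notMem]
      rintro ⟨x, hx, rfl⟩
      rw [iterate_succ_apply'] at hy
      exact hy (mem_image_of_mem ψ ((hψ.iterate m).mapsTo hx))

/-- The weighted composition operator, as the transpose of `transferCLM`. -/
noncomputable def weightedCompositionCLM
    (hψ : IsSmoothSelfEmbedding (X : Set (EuclideanSpace ℝ (Fin d))) ψ)
    (hw : ContDiffOn ℝ ∞ w X) : Distr X →L[ℂ] Distr X :=
  ContinuousLinearMap.precomp ℂ (transferCLM hψ hw)

theorem iterate_weightedCompositionCLM_apply
    (hψ : IsSmoothSelfEmbedding (X : Set (EuclideanSpace ℝ (Fin d))) ψ)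
    (hw : ContDiffOn ℝ ∞ w X) (m : ℕ) (u : Distr X) (f : 𝓓(X, ℂ)) :
    ((weightedCompositionCLM hψ hw)^[m] u) f = u ((transferCLM hψ hw)^[m] f) := by
  induction m generalizing u with
  | zero => rfl
  | succ m ih =>
    rw [iterate_succ_apply, ih, iterate_succ_apply']
    rfl

/-- Substituting `y = ψ x` in the integral over `ψ(X)` produces `|det Jψ|`, which cancels the
denominator of the weight factor. -/
theorem isWeightedCompositionOperator_weightedCompositionCLM
    (hψ : IsSmoothSelfEmbedding (X : Set (EuclideanSpace ℝ (Fin d))) ψ)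
    (hw : ContDiffOn ℝ ∞ w X) :
    IsWeightedCompositionOperator X w ψ (weightedCompositionCLM hψ hw) := by
  intro g hg
  ext f
  change regularDistr X g (transferCLM hψ hw f) = _
  have hg' : ContinuousOn (fun x ↦ w x * g (ψ x)) X :=
    hw.continuousOn.mul (hg.comp hψ.contDiffOn.continuousOn hψ.mapsTo)
  rw [regularDistr_apply hg, regularDistr_apply hg', transferCLM, coe_pushCLM]
  have h1 : ∀ y, pushFun X ψ (weightFactor w ψ) f y * g y =
      indicator (ψ '' X) (fun y ↦ pushFun X ψ (weightFactor w ψ) f y * g y) y := by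
    intro y
    by_cases hy : y ∈ ψ '' X
    · rw [indicator_of_mem hy]
    · rw [indicator_of_notMem hy, pushFun_of_notMem hy, zero_mul]
  have h2 : ∀ x, f x * (w x * g (ψ x)) =
      indicator (X : Set (EuclideanSpace ℝ (Fin d))) (fun x ↦ f x * (w x * g (ψ x))) x := by
    intro x
    by_cases hx : x ∈ (X : Set (EuclideanSpace ℝ (Fin d)))
    · rw [indicator_of_mem hx]
    · rw [indicator_of_notMem hx, image_eq_zero_of_notMem_tsupport fun h ↦ hx (f.tsupport_subset h),
        zero_mul]
  rw [integral_congr_ae (Filter.Eventually.of_forall h1),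
    integral_congr_ae (Filter.Eventually.of_forall h2),
    integral_indicator (hψ.isOpen_image X.isOpen subset_rfl).measurableSet,
    integral_indicator X.isOpen.measurableSet,
    integral_image_eq_integral_abs_det_fderiv_smul volume X.isOpen.measurableSet
      (fun x hx ↦ (hψ.differentiableAt hx).hasFDerivAt.hasFDerivWithinAt) hψ.injOn]
  refine setIntegral_congr_fun X.isOpen.measurableSet fun x hx ↦ ?_
  have hdet : ((|(fderiv ℝ ψ x).det| : ℝ) : ℂ) ≠ 0 := by simpa using hψ.det_ne_zero x hx
  simp only [pushFun_apply hψ hx, weightFactor, Complex.real_smul]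
  field_simp

end Operator

/-! ### Power boundedness: sufficient and necessary conditions. -/

section PowerBounded

variable {d : ℕ} {X : Opens (EuclideanSpace ℝ (Fin d))} {w : EuclideanSpace ℝ (Fin d) → ℂ}
  {ψ : EuclideanSpace ℝ (Fin d) → EuclideanSpace ℝ (Fin d)}

theorem isPowerBounded_of_bounds
    (hψ : IsSmoothSelfEmbedding (X : Set (EuclideanSpace ℝ (Fin d))) ψ)
    (hw : ContDiffOn ℝ ∞ w X) (hstab : HasStableOrbits (X : Set (EuclideanSpace ℝ (Fin d))) ψ)
    (ha : WeightProductsBounded X w ψ) (hb : InverseComponentsBounded X ψ) :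
    IsPowerBounded (weightedCompositionCLM hψ hw) := by
  intro p hp
  obtain ⟨B, hB, c, hc, hpB⟩ := exists_isVonNBounded_of_continuous_seminorm hp
  obtain ⟨K, hK, hBK⟩ := exists_compact_of_isVonNBounded hB
  obtain ⟨L, hL, hLX, hKL⟩ := hstab K K.isCompact hK
  have hsupp : ∀ f ∈ B, ∀ m, tsupport ((transferCLM hψ hw)^[m] f) ⊆ ψ^[m] '' K := fun f hf m ↦ by
    rw [coe_iterate_transferCLM]
    exact tsupport_pushFun_subset (hψ.iterate m) K.isCompact hK (hBK f hf)
  -- The union of the orbits of `B`. Once it is bounded, its sup-seminorm dominates all the `p (C^m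
  -- u)` up to the factor `c`.
  let B' : Set 𝓓(X, ℂ) := {g | ∃ m, ∃ f ∈ B, (transferCLM hψ hw)^[m] f = g}
  have hB' : Bornology.IsVonNBounded ℂ B' := by
    refine isVonNBounded_of_bounds (K := ⟨L, hL⟩) hLX ?_ fun n ↦ ?_
    · rintro _ ⟨m, f, hf, rfl⟩
      exact (hsupp f hf m).trans (hKL m)
    · obtain ⟨A, hA0, hA⟩ := exists_norm_iteratedFDeriv_bound (ha K K.isCompact hK n)
      choose D hD0 hD using fun c ↦ exists_norm_iteratedFDeriv_bound (hb K K.isCompact hK n c)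
      choose M hM0 hM using exists_iteratedFDeriv_bound_of_isVonNBounded hB
      have hDsum : 0 ≤ ∑ c, D c := Finset.sum_nonneg fun c _ ↦ hD0 c
      have hMsum : 0 ≤ ∑ i ∈ Finset.range (n + 1), M i := Finset.sum_nonneg fun i _ ↦ (hM0 i).le
      -- The summand `1` secures the requirement that the bound on the inverse be at least `1`.
      refine ⟨2 ^ n * A * (n.factorial * (∑ i ∈ Finset.range (n + 1), M i) * (1 + ∑ c, D c) ^ n),
        ?_⟩
      rintro _ ⟨m, f, hf, rfl⟩ y -
      by_cases hy : y ∈ ψ^[m] '' K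
      · have hyX : y ∈ ψ^[m] '' X := image_mono hK hy
        rw [coe_iterate_transferCLM]
        refine norm_iteratedFDeriv_pushFun_le (hψ.iterate m) (contDiffOn_weightProduct hψ hw m)
          f.contDiff hyX (fun i hi ↦ hA m i hi y hy) (fun i hi ↦ ?_)
          (le_add_of_nonneg_right hDsum) (fun i hi x ↦ ?_)
        · have hinv := (hψ.iterate m).contDiffOn_invFunOn.contDiffAt
            (((hψ.iterate m).isOpen_image X.isOpen subset_rfl).mem_nhds hyX)
          refine (norm_iteratedFDeriv_le_sum_components hinv i).trans ?_
          exact (Finset.sum_le_sum fun c _ ↦ hD c m i hi y hy).trans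
            (le_add_of_nonneg_left zero_le_one)
        · exact (hM i f hf x).trans (Finset.single_le_sum (f := M) (fun i _ ↦ (hM0 i).le)
            (Finset.mem_range_succ_iff.2 hi))
      · have h0 : iteratedFDeriv ℝ n ((transferCLM hψ hw)^[m] f) y = 0 := by
          by_contra hne
          exact hy (hsupp f hf m (support_iteratedFDeriv_subset n hne))
        rw [h0, norm_zero]
        positivity
  have hq : Continuous (c.toNNReal • supSeminorm B' hB') :=
    (continuous_supSeminorm hB').const_smul c.toNNReal
  refine ⟨c.toNNReal • supSeminorm B' hB', hq, fun m u ↦ le_of_forall_pos_le_add fun ε hε ↦ ?_⟩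
  -- `hpB` needs a positive bound and the seminorm may vanish, hence the extra `ε / c`.
  have h1 := hpB ((weightedCompositionCLM hψ hw)^[m] u) (supSeminorm B' hB' u + ε / c)
    (by positivity) fun f hf ↦ by
      rw [iterate_weightedCompositionCLM_apply]
      exact (le_supSeminorm hB' u ⟨m, f, hf, rfl⟩).trans (le_add_of_nonneg_right (by positivity))
  refine h1.trans_eq ?_
  rw [smul_apply, NNReal.smul_def, smul_eq_mul, Real.coe_toNNReal c hc.le, mul_add,
    mul_div_cancel₀ ε hc.ne']

/-- The distribution `f ↦ D^k f(y) v`. -/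
noncomputable def derivEvalCLM (X : Opens (EuclideanSpace ℝ (Fin d))) (k : ℕ)
    (y : EuclideanSpace ℝ (Fin d)) (v : Fin k → EuclideanSpace ℝ (Fin d)) : Distr X :=
  TestFunction.mkCLM ℂ (fun f ↦ iteratedFDeriv ℝ k f y v)
    (fun f g ↦ by
      have : (⇑(f + g) : _ → ℂ) = ⇑f + ⇑g := rfl
      rw [this, iteratedFDeriv_add_apply (f.contDiff.of_le (mod_cast le_top)).contDiffAt
        (g.contDiff.of_le (mod_cast le_top)).contDiffAt]
      rfl)
    (fun a f ↦ by
      have : (⇑(a • f) : _ → ℂ) = a • ⇑f := rfl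
      rw [this, iteratedFDeriv_const_smul_apply (f.contDiff.of_le (mod_cast le_top)).contDiffAt]
      rfl)
    (fun K hK ↦ (ContDiffMapSupportedIn.mkCLMtoNormedSpace ℂ (K := K) (n := ⊤) (F := ℂ)
      (fun f ↦ iteratedFDeriv ℝ k f y v)
      (fun f g ↦ by
        have : (⇑(f + g) : _ → ℂ) = ⇑f + ⇑g := rfl
        rw [this, iteratedFDeriv_add_apply (f.contDiff.of_le (mod_cast le_top)).contDiffAt
          (g.contDiff.of_le (mod_cast le_top)).contDiffAt]
        rfl)
      (fun a f ↦ by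
        have : (⇑(a • f) : _ → ℂ) = a • ⇑f := rfl
        rw [this, iteratedFDeriv_const_smul_apply (f.contDiff.of_le (mod_cast le_top)).contDiffAt]
        rfl)
      ⟨{k}, ∏ i, ‖v i‖, by positivity, fun f ↦ by
        rw [Finset.sup_singleton, mul_comm]
        refine (ContinuousMultilinearMap.le_opNorm _ _).trans ?_
        gcongr
        exact ContDiffMapSupportedIn.norm_iteratedFDeriv_apply_le_seminorm_top ℂ⟩).continuous)

theorem derivEvalCLM_apply (k : ℕ) (y : EuclideanSpace ℝ (Fin d))
    (v : Fin k → EuclideanSpace ℝ (Fin d)) (f : 𝓓(X, ℂ)) :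
    derivEvalCLM X k y v f = iteratedFDeriv ℝ k f y v := rfl

/-- If the weighted composition operator is power bounded, then the orbit of a test function under
the transpose is supported in a common compact set and has uniformly bounded derivatives. -/
theorem exists_bounds_of_isPowerBounded
    (hψ : IsSmoothSelfEmbedding (X : Set (EuclideanSpace ℝ (Fin d))) ψ)
    (hw : ContDiffOn ℝ ∞ w X) (h : IsPowerBounded (weightedCompositionCLM hψ hw)) (f : 𝓓(X, ℂ)) :
    (∃ L : Set (EuclideanSpace ℝ (Fin d)), IsCompact L ∧ L ⊆ X ∧
      ∀ m, ∀ y ∉ L, (transferCLM hψ hw)^[m] f y = 0) ∧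
    ∀ k, ∃ M : ℝ, ∀ m y, ‖iteratedFDeriv ℝ k ((transferCLM hψ hw)^[m] f) y‖ ≤ M := by
  have hf : Bornology.IsVonNBounded ℂ {f} := isVonNBounded_singleton f
  obtain ⟨q, hq, hpq⟩ := h (supSeminorm {f} hf) (continuous_supSeminorm hf)
  obtain ⟨B, hB, c, hc, hqB⟩ := exists_isVonNBounded_of_continuous_seminorm hq
  have key : ∀ (u : Distr X) (M : ℝ), 0 < M → (∀ g ∈ B, ‖u g‖ ≤ M) →
      ∀ m, ‖u ((transferCLM hψ hw)^[m] f)‖ ≤ c * M := fun u M hM hu m ↦ by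
    rw [← iterate_weightedCompositionCLM_apply]
    exact (le_supSeminorm hf _ (mem_singleton f)).trans ((hpq m u).trans (hqB u M hM hu))
  constructor
  · obtain ⟨L, hL, hBL⟩ := exists_compact_of_isVonNBounded hB
    refine ⟨L, L.isCompact, hL, fun m y hy ↦ norm_le_zero_iff.1 ?_⟩
    refine le_of_forall_pos_le_add fun ε hε ↦ ?_
    have h1 := key (derivEvalCLM X 0 y 0) (ε / c) (by positivity) (fun g hg ↦ by
      rw [derivEvalCLM_apply, iteratedFDeriv_zero_apply,
        image_eq_zero_of_notMem_tsupport fun hyg ↦ hy (hBL g hg hyg), norm_zero]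
      positivity) m
    rwa [derivEvalCLM_apply, iteratedFDeriv_zero_apply, mul_div_cancel₀ ε hc.ne', ← zero_add ε]
      at h1
  · intro k
    obtain ⟨M, hM, hBM⟩ := exists_iteratedFDeriv_bound_of_isVonNBounded hB k
    refine ⟨c * M, fun m y ↦ norm_le_of_apply_le _ (by positivity) fun v hv ↦ ?_⟩
    exact key (derivEvalCLM X k y fun i ↦ v i) M hM (fun g hg ↦
      (norm_iteratedFDeriv_apply_le_of_norm_le_one _ hv).trans (hBM g hg y)) m

/-- The value `1` on a neighbourhood of `K`, not merely on `K`, lets derivatives of weight products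
be read off from iterates of `f`. -/
theorem exists_testFunction_eq_one {K : Set (EuclideanSpace ℝ (Fin d))} (hK : IsCompact K)
    (hKX : K ⊆ X) : ∃ f : 𝓓(X, ℂ), ∀ᶠ x in nhdsSet K, f x = 1 := by
  obtain ⟨L, hL, hKL, hLX⟩ := exists_compact_between hK X.isOpen hKX
  obtain ⟨g, hg1, hg0, -⟩ := exists_contMDiffMap_one_nhds_of_subset_interior (n := (⊤ : ℕ∞))
    (modelWithCornersSelf ℝ (EuclideanSpace ℝ (Fin d))) hK.isClosed hKL
  have hsupp : tsupport (fun x ↦ (g x : ℂ)) ⊆ L := by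
    refine closure_minimal (fun x hx ↦ ?_) hL.isClosed
    by_contra hxL
    exact hx (by simp [hg0 x hxL])
  refine ⟨⟨fun x ↦ (g x : ℂ), Complex.ofRealCLM.contDiff.comp g.contMDiff.contDiff,
    hL.of_isClosed_subset (isClosed_tsupport _) hsupp, hsupp.trans hLX⟩, ?_⟩
  filter_upwards [hg1] with x hx
  change (g x : ℂ) = 1
  rw [hx, Complex.ofReal_one]

/-- Induction on `m`: the part of `U` where the product is nonzero is open and nonempty, and `ψ^m`
maps it onto an open subset of `X`, which meets the dense set where `w` is nonzero. -/
theorem exists_weightProduct_ne_zero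
    (hψ : IsSmoothSelfEmbedding (X : Set (EuclideanSpace ℝ (Fin d))) ψ) (hw : ContDiffOn ℝ ∞ w X)
    (hdense : (X : Set (EuclideanSpace ℝ (Fin d))) ⊆ closure {x | x ∈ X ∧ w x ≠ 0}) (m : ℕ)
    {U : Set (EuclideanSpace ℝ (Fin d))} (hU : IsOpen U) (hUX : U ⊆ X) (hne : U.Nonempty) :
    ∃ x ∈ U, weightProduct w ψ m x ≠ 0 := by
  induction m generalizing U with
  | zero =>
    obtain ⟨x, hx⟩ := hne
    exact ⟨x, hx, by simp [weightProduct]⟩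
  | succ m ih =>
    obtain ⟨x, hx, hxW⟩ := ih hU hUX hne
    have hU' : IsOpen (U ∩ weightProduct w ψ m ⁻¹' {0}ᶜ) :=
      ((contDiffOn_weightProduct hψ hw m).continuousOn.mono hUX).isOpen_inter_preimage hU
        isOpen_compl_singleton
    have hV := (hψ.iterate m).isOpen_image hU' (inter_subset_left.trans hUX)
    have hxm : ψ^[m] x ∈ closure {x | x ∈ X ∧ w x ≠ 0} :=
      hdense ((hψ.iterate m).mapsTo (hUX hx))
    obtain ⟨_, ⟨z, ⟨hzU, hzW⟩, rfl⟩, hzX, hzw⟩ :=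
      mem_closure_iff.1 hxm _ hV (mem_image_of_mem _ ⟨hx, hxW⟩)
    refine ⟨z, hzU, ?_⟩
    rw [weightProduct_succ]
    refine mul_ne_zero hzW (div_ne_zero hzw ?_)
    simpa using hψ.det_ne_zero _ hzX

theorem bounds_of_isPowerBounded
    (hψ : IsSmoothSelfEmbedding (X : Set (EuclideanSpace ℝ (Fin d))) ψ) (hw : ContDiffOn ℝ ∞ w X)
    (hdense : (X : Set (EuclideanSpace ℝ (Fin d))) ⊆ closure {x | x ∈ X ∧ w x ≠ 0})
    (h : IsPowerBounded (weightedCompositionCLM hψ hw)) :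
    HasStableOrbits (X : Set (EuclideanSpace ℝ (Fin d))) ψ ∧ WeightProductsBounded X w ψ := by
  constructor
  · intro K hK hKX
    obtain ⟨f, hf⟩ := exists_testFunction_eq_one hK hKX
    obtain ⟨⟨L, hL, hLX, hfL⟩, -⟩ := exists_bounds_of_isPowerBounded hψ hw h f
    refine ⟨L, hL, hLX, ?_⟩
    rintro m _ ⟨x, hx, rfl⟩
    by_contra hxL
    -- The weight product may vanish at `x` itself, so `x` is moved to a nearby `z` where it does
    -- not, keeping `ψ^m z ∉ L` and `f z ≠ 0`. Then the `m`-th iterate of `f` is nonzero at `ψ^m z`,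
    -- a contradiction.
    have hU : IsOpen ((X : Set (EuclideanSpace ℝ (Fin d))) ∩ ψ^[m] ⁻¹' Lᶜ) :=
      (hψ.iterate m).contDiffOn.continuousOn.isOpen_inter_preimage X.isOpen hL.isClosed.isOpen_compl
    have hV : IsOpen (f ⁻¹' {0}ᶜ) := isOpen_compl_singleton.preimage f.continuous
    have hfx : f x = 1 := hf.self_of_nhdsSet x hx
    obtain ⟨z, ⟨⟨hzX, hzL⟩, hzf⟩, hzW⟩ := exists_weightProduct_ne_zero hψ hw hdense m (hU.inter hV)
      (inter_subset_left.trans inter_subset_left) ⟨x, ⟨hKX hx, hxL⟩, by simp [hfx]⟩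
    have h0 := hfL m _ hzL
    rw [coe_iterate_transferCLM, pushFun_apply (hψ.iterate m) hzX] at h0
    exact mul_ne_zero hzW hzf h0
  · intro K hK hKX n
    obtain ⟨f, hf⟩ := exists_testFunction_eq_one hK hKX
    choose M hM using (exists_bounds_of_isPowerBounded hψ hw h f).2
    refine iSup_cnSeminorm_lt_top (M := ∑ k ∈ Finset.range (n + 1), |M k|) fun m k hk y hy ↦ ?_
    obtain ⟨x, hx, rfl⟩ := hy
    have hn : {x | f x = 1} ∈ nhds x := Filter.mem_of_superset (mem_nhdsSet_iff_forall.1 hf x hx)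
      subset_rfl
    obtain ⟨V, hVsub, hV, hxV⟩ := mem_nhds_iff.1 (Filter.inter_mem hn (X.isOpen.mem_nhds (hKX hx)))
    have heq : weightProduct w ψ m ∘ iterateInv X ψ m =ᶠ[nhds (ψ^[m] x)]
        ((transferCLM hψ hw)^[m] f) := by
      filter_upwards [((hψ.iterate m).isOpen_image hV fun z hz ↦ (hVsub hz).2).mem_nhds
        (mem_image_of_mem _ hxV)]
      rintro _ ⟨z, hz, rfl⟩
      have hz1 : f z = 1 := (hVsub hz).1
      rw [coe_iterate_transferCLM, pushFun_apply (hψ.iterate m) (hVsub hz).2, hz1, mul_one,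
        comp_apply, iterateInv, (hψ.iterate m).invFunOn_apply (hVsub hz).2]
    rw [(heq.iteratedFDeriv ℝ k).eq_of_nhds]
    exact (hM k m _).trans ((le_abs_self _).trans (Finset.single_le_sum (f := fun k ↦ |M k|)
      (fun _ _ ↦ abs_nonneg _) (Finset.mem_range_succ_iff.2 hk)))

end PowerBounded

end WeightedComposition

theorem mainTheorem3 {d : ℕ} (X : Opens (EuclideanSpace ℝ (Fin d)))
    (w : EuclideanSpace ℝ (Fin d) → ℂ) (hw : ContDiffOn ℝ ∞ w X)
    (hw_dense : (X : Set (EuclideanSpace ℝ (Fin d))) ⊆ closure {x | x ∈ X ∧ w x ≠ 0})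
    (ψ : EuclideanSpace ℝ (Fin d) → EuclideanSpace ℝ (Fin d)) (hψ : ContDiffOn ℝ ∞ ψ X)
    (hψ_maps : MapsTo ψ X X) (hψ_inj : InjOn ψ X) (hψ_det : ∀ x ∈ X, (fderiv ℝ ψ x).det ≠ 0) :
    -- the weighted composition operator on `𝓓'(X)` exists and is unique
    (∃! T : WeightedComposition.Distr X →L[ℂ] WeightedComposition.Distr X,
      WeightedComposition.IsWeightedCompositionOperator X w ψ T) ∧
    ∀ C : WeightedComposition.Distr X →L[ℂ] WeightedComposition.Distr X,
      WeightedComposition.IsWeightedCompositionOperator X w ψ C →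
      -- i) implies ii)
      ((WeightedComposition.HasStableOrbits (X : Set (EuclideanSpace ℝ (Fin d))) ψ ∧
          WeightedComposition.WeightProductsBounded X w ψ ∧
          WeightedComposition.InverseComponentsBounded X ψ →
        WeightedComposition.IsPowerBounded C) ∧
      -- ii) implies iii)
      (WeightedComposition.IsPowerBounded C →
        WeightedComposition.HasStableOrbits (X : Set (EuclideanSpace ℝ (Fin d))) ψ ∧
          WeightedComposition.WeightProductsBounded X w ψ)) := by
  have hψ' : WeightedComposition.IsSmoothSelfEmbedding (X : Set (EuclideanSpace ℝ (Fin d))) ψ :=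
    ⟨hψ, hψ_maps, hψ_inj, hψ_det⟩
  have hT := WeightedComposition.isWeightedCompositionOperator_weightedCompositionCLM hψ' hw
  have huniq : ∀ C : WeightedComposition.Distr X →L[ℂ] WeightedComposition.Distr X,
      WeightedComposition.IsWeightedCompositionOperator X w ψ C →
        C = WeightedComposition.weightedCompositionCLM hψ' hw := fun C hC ↦
    WeightedComposition.eq_of_eq_on_regularDistr fun g hg ↦ (hC g hg).trans (hT g hg).symm
  refine ⟨⟨_, hT, huniq⟩, fun C hC ↦ ?_⟩
  rw [huniq C hC]
  exact ⟨fun h ↦ WeightedComposition.isPowerBounded_of_bounds hψ' hw h.1 h.2.1 h.2.2,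
    WeightedComposition.bounds_of_isPowerBounded hψ' hw hw_dense⟩
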